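/- Let $M$ be a smooth manifold (Hausdorff, $\sigma$-compact, without boundary), let $(A,\rho_A,[\cdot,\cdot])$ be a Lie algebroid on $M$, i.e. a smooth real vector bundle $A\to M$ of finite rank with a smooth bundle map $\rho_A:A\to TM$ over $\mathrm{id}_M$ and an $\mathbb{R}$-Lie algebra bracket on the space $\Gamma(A)$ of smooth sections such that $[a,fb]=f[a,b]+(\rho_A\circ a)(f)\,b$ for $a,b\in\Gamma(A)$, $f\in C^\infty(M)$, and let $E\to M$ be a smooth real vector bundle of finite rank. *Forms and cohomology.* $\mathcal{A}lt^k_{\mathbb R}(\Gamma(A);C^\infty(M))$ is the space of alternating $\mathbb{R}$-multilinear (not necessarily $C^\infty(M)$-multilinear) maps $\Gamma(A)^k\to C^\infty(M)$, with the differential $$(d_{A,\mathbb R}\eta)(a_0,\dots,a_k)=\sum_i(-1)^i(\rho_A\circ a_i)\big(\eta(a_0,..\hat a_i..,a_k)\big)+\sum_{i<j}(-1)^{i+j}\eta([a_i,a_j],a_0,..\hat a_i..\hat a_j..,a_k).$$ $H^k_{\rho_A,\mathbb R}(A;M\times\mathbb R)$ is the space of closed $k$-forms modulo exact $k$-forms,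 and $H_{\rho_A,\mathbb R}(A;M\times\mathbb R)=\bigoplus_{k\ge 0}H^k_{\rho_A,\mathbb R}(A;M\times\mathbb R)$. *Connections.* An $\mathbb{R}$-linear $A$-connection $\nabla$ on $E$ is an $\mathbb{R}$-linear map $a\mapsto\nabla_a$ from $\Gamma(A)$ to $\mathrm{End}_{\mathbb R}(\Gamma(E))$ with $\nabla_a(f\nu)=f\nabla_a\nu+(\rho_A\circ a)(f)\nu$. Its curvature $R^\nabla_{a,b}=\nabla_a\nabla_b-\nabla_b\nabla_a-\nabla_{[a,b]}$ is $C^\infty(M)$-linear on $\Gamma(E)$, i.e. $R^\nabla_{a,b}\in\Gamma(\mathrm{End}\,E)$. Put $$(R^\nabla)^p(a_1,\dots,a_{2p})=\frac1{2^p}\sum_{\tau\in S_{2p}}\mathrm{sgn}(\tau)\,R^\nabla_{a_{\tau(1)},a_{\tau(2)}}\circ\cdots\circ R^\nabla_{a_{\tau(2p-1)},a_{\tau(2p)}},$$ and $\mathrm{ch}_p(\nabla)=\mathrm{Tr}\big((R^\nabla)^p\big)\in\mathcal{A}lt^{2p}_{\mathbb R}(\Gamma(A);C^\infty(M))$ with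 the fibrewise trace, for $p\ge1$. *Chern–Simons forms.* Let $\mathrm{pr}_2:\mathbb R\times M\to M$. For $\mathbb R$-linear $A$-connections $\nabla^0,\nabla^1$ on $E$ let $\nabla^{\mathrm{aff}}$ be the connection on $\mathrm{pr}_2^*E$ along the Lie algebra $\mathbb R\,\frac{\partial}{\partial t}\oplus\Gamma(A)$ (with $[\frac{\partial}{\partial t},a]=0$, acting on $C^\infty(\mathbb R\times M)$ by $\frac{\partial}{\partial t}$ and, slicewise in $t$, by $\rho_A\circ a$) given, for $\sigma\in\Gamma(\mathrm{pr}_2^*E)$, by $$\nabla^{\mathrm{aff}}_{\partial/\partial t}\sigma=\frac{\partial\sigma}{\partial t},\qquad(\nabla^{\mathrm{aff}}_a\sigma)(t,\cdot)=(1-t)\,\nabla^0_a(\sigma(t,\cdot))+t\,\nabla^1_a(\sigma(t,\cdot)).$$ With curvature and $\mathrm{ch}_p(\nabla^{\mathrm{aff}})$ defined by the same formulas, put $$\mathrm{cs}_p(\nabla^0,\nabla^1)(a_1,\dots,a_{2p-1})=\int_0^1\mathrm{ch}_p(\nabla^{\mathrm{aff}})\Big(\frac{\partial}{\partial t},a_1,\dots,a_{2p-1}\Big)\Big|_{(t,\cdot)}dt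 .$$ **Corollary (Chern character).** 1. For every $\mathbb R$-linear $A$-connection $\nabla$ on $E$ and every $p\ge1$, $d_{A,\mathbb R}(\mathrm{ch}_p(\nabla))=0$. 2. For all $\mathbb R$-linear $A$-connections $\nabla^0,\nabla^1$ on $E$ and every $p\ge1$, $d_{A,\mathbb R}\big(\mathrm{cs}_p(\nabla^0,\nabla^1)\big)=\mathrm{ch}_p(\nabla^1)-\mathrm{ch}_p(\nabla^0)$. 3. Consequently the class $\mathrm{ch}_p(A,E)=[\mathrm{ch}_p(\nabla)]\in H^{2p}_{\rho_A,\mathbb R}(A;M\times\mathbb R)$ does not depend on $\nabla$. 4. The Chern character $\mathrm{ch}(A,E)=\sum_{p\ge1}\mathrm{ch}_p(A,E)$ is a well-defined element of $H_{\rho_A,\mathbb R}(A;M\times\mathbb R)$: there is exactly one element of $\bigoplus_kH^k_{\rho_A,\mathbb R}(A;M\times\mathbb R)$ whose component of degree $2p$ is $[\mathrm{ch}_p(\nabla)]$ for every $p\ge1$ and every $\mathbb R$-linear $A$-connection $\nabla$ on $E$, and whose other components vanish. -/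

import Mathlib

open Bundle Manifold ContDiff Topology

noncomputable section

section Generic

variable {E : Type*} [NormedAddCommGroup E] [NormedSpace ℝ E]
  {H : Type*} [TopologicalSpace H] {I : ModelWithCorners ℝ E H}
  {N : Type*} [TopologicalSpace N] [ChartedSpace H N]
  {F : Type*} [NormedAddCommGroup F] [NormedSpace ℝ F]
  {V : N → Type*} [TopologicalSpace (TotalSpace F V)] [∀ x, AddCommGroup (V x)]
  [∀ x, Module ℝ (V x)] [∀ x, TopologicalSpace (V x)] [FiberBundle F V] [VectorBundle ℝ F V]

/-- Smooth sections form a module over the ring of smooth functions. -/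
instance ContMDiffSection.instModuleSmooth :
    Module C^∞⟮I, N; 𝓘(ℝ, ℝ), ℝ⟯ Cₛ^∞⟮I; F, V⟯ where
  smul f s := ⟨fun x => f x • s x, f.contMDiff.smul_section s.contMDiff⟩
  one_smul s := ContMDiffSection.ext fun x => one_smul ℝ (s x)
  mul_smul f g s := ContMDiffSection.ext fun x => mul_smul (f x) (g x) (s x)
  smul_zero f := ContMDiffSection.ext fun x => smul_zero (f x)
  smul_add f s t := ContMDiffSection.ext fun x => smul_add (f x) (s x) (t x)
  add_smul f g s := ContMDiffSection.ext fun x => add_smul (f x) (g x) (s x)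
  zero_smul s := ContMDiffSection.ext fun x => zero_smul ℝ (s x)

@[simp] theorem ContMDiffSection.smooth_smul_apply (f : C^∞⟮I, N; 𝓘(ℝ, ℝ), ℝ⟯)
    (s : Cₛ^∞⟮I; F, V⟯) (x : N) : (f • s) x = f x • s x := rfl

instance ContMDiffSection.instIsScalarTowerSmooth :
    IsScalarTower ℝ C^∞⟮I, N; 𝓘(ℝ, ℝ), ℝ⟯ Cₛ^∞⟮I; F, V⟯ where
  smul_assoc c f s := ContMDiffSection.ext fun x => mul_smul c (f x) (s x)

instance ContMDiffSection.instSMulCommSmooth :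
    SMulCommClass ℝ C^∞⟮I, N; 𝓘(ℝ, ℝ), ℝ⟯ Cₛ^∞⟮I; F, V⟯ where
  smul_comm c f s := ContMDiffSection.ext fun x => smul_comm c (f x) (s x)

variable [IsManifold I ∞ N]

/-- The derivation `f ↦ X(f)` of the algebra of smooth functions given by a smooth vector
field `X`. -/
def vectorFieldDerivation (X : Cₛ^∞⟮I; E, (TangentSpace I : N → Type _)⟯) :
    Derivation ℝ C^∞⟮I, N; 𝓘(ℝ, ℝ), ℝ⟯ C^∞⟮I, N; 𝓘(ℝ, ℝ), ℝ⟯ :=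
  Derivation.mk'
    { toFun := fun f => ⟨fun x => (mfderiv I 𝓘(ℝ, ℝ) f x (X x) : ℝ), by
        have h1 := f.contMDiff.contMDiff_tangentMap (m := ∞) (by simp)
        have h2 := (contMDiff_snd_tangentBundle_modelSpace (n := ∞) ℝ 𝓘(ℝ, ℝ)).comp
          (h1.comp X.contMDiff)
        exact h2⟩
      map_add' := fun f g => by
        ext x
        have := mfderiv_add (f.mdifferentiableAt (x := x)) (g.mdifferentiableAt (x := x))
        exact congrArg (fun L => L (X x)) this
      map_smul' := fun c f => by
        ext x
        have := const_smul_mfderiv (f.mdifferentiableAt (x := x)) c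
        exact congrArg (fun L => L (X x)) this }
    (fun f g => by
        ext x
        have := ((f.mdifferentiableAt (x := x)).hasMFDerivAt.mul
          (g.mdifferentiableAt (x := x)).hasMFDerivAt).mfderiv
        exact congrArg (fun L => L (X x)) this )

@[simp] theorem vectorFieldDerivation_apply
    (X : Cₛ^∞⟮I; E, (TangentSpace I : N → Type _)⟯) (f : C^∞⟮I, N; 𝓘(ℝ, ℝ), ℝ⟯) (x : N) :
    vectorFieldDerivation X f x = (mfderiv I 𝓘(ℝ, ℝ) f x (X x) : ℝ) := rfl

theorem vectorFieldDerivation_add (X Y : Cₛ^∞⟮I; E, (TangentSpace I : N → Type _)⟯) :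
    vectorFieldDerivation (X + Y) = vectorFieldDerivation X + vectorFieldDerivation Y :=
  Derivation.ext fun f => ContMDiffMap.ext fun x =>
    (mfderiv I 𝓘(ℝ, ℝ) f x).map_add (X x) (Y x)

theorem vectorFieldDerivation_smul (c : ℝ) (X : Cₛ^∞⟮I; E, (TangentSpace I : N → Type _)⟯) :
    vectorFieldDerivation (c • X) = c • vectorFieldDerivation X :=
  Derivation.ext fun f => ContMDiffMap.ext fun x =>
    (mfderiv I 𝓘(ℝ, ℝ) f x).map_smul c (X x)

end Generic

section Generic

variable {E : Type*} [NormedAddCommGroup E] [NormedSpace ℝ E]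
  {H : Type*} [TopologicalSpace H] {I : ModelWithCorners ℝ E H}
  {N : Type*} [TopologicalSpace N] [ChartedSpace H N]
  {F : Type*} [NormedAddCommGroup F] [NormedSpace ℝ F]
  {V : N → Type*} [TopologicalSpace (TotalSpace F V)] [∀ x, AddCommGroup (V x)]
  [∀ x, Module ℝ (V x)] [∀ x, TopologicalSpace (V x)] [FiberBundle F V] [VectorBundle ℝ F V]
  [IsManifold I ∞ N]

theorem ContMDiffSection.sum_apply' {ι : Type*} (t : Finset ι) (f : ι → Cₛ^∞⟮I; F, V⟯) (x : N) :
    (∑ i ∈ t, f i) x = ∑ i ∈ t, f i x := by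
  classical
  induction t using Finset.induction_on with
  | empty => simp
  | insert i t hi ih => simp [Finset.sum_insert hi, ih]

/-- A smooth function, from a function and a proof of smoothness. -/
def smoothFun (f : N → ℝ) (hf : ContMDiff I 𝓘(ℝ, ℝ) ∞ f) : C^∞⟮I, N; 𝓘(ℝ, ℝ), ℝ⟯ := ⟨f, hf⟩

@[simp] theorem smoothFun_apply (f : N → ℝ) (hf : ContMDiff I 𝓘(ℝ, ℝ) ∞ f) (x : N) :
    smoothFun f hf x = f x := rfl

variable [FiniteDimensional ℝ E] [T2Space N] [FiniteDimensional ℝ F]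
  [ContMDiffVectorBundle ∞ F V I]

/-- Near any point, a vector bundle has a cut-off local frame: global sections `s i`, fibrewise
linear smooth functions `c i` on the total space, and a bump function `χ` with
`χ(x) v = ∑ c i (v) s i (x)`. -/
theorem exists_cutoff_frame (I : ModelWithCorners ℝ E H) [IsManifold I ∞ N]
    [ContMDiffVectorBundle ∞ F V I] (x₀ : N) :
    ∃ (r : ℕ) (χ : C^∞⟮I, N; 𝓘(ℝ, ℝ), ℝ⟯) (s : Fin r → Cₛ^∞⟮I; F, V⟯)
      (c : Fin r → ∀ x, V x →ₗ[ℝ] ℝ),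
      (∀ᶠ x in 𝓝 x₀, χ x = 1) ∧
      (∀ i, ContMDiff (I.prod 𝓘(ℝ, F)) 𝓘(ℝ, ℝ) ∞ (fun u : TotalSpace F V => c i u.1 u.2)) ∧
      ∀ x (v : V x), χ x • v = ∑ i, c i x v • s i x := by
  classical
  let e := trivializationAt F V x₀
  let b := Module.finBasis ℝ F
  have hx₀ : x₀ ∈ e.baseSet := FiberBundle.mem_baseSet_trivializationAt' x₀
  obtain ⟨g, -, hg⟩ := (SmoothBumpFunction.nhds_basis_tsupport (I := I) x₀).mem_iff.1
    (e.open_baseSet.mem_nhds hx₀)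
  let gs : C^∞⟮I, N; 𝓘(ℝ, ℝ), ℝ⟯ := ⟨g, g.contMDiff⟩
  have hs : ∀ i, ContMDiff I (I.prod 𝓘(ℝ, F)) ∞
      (fun x => (⟨x, ((g : N → ℝ) • e.localFrame b i) x⟩ : TotalSpace F V)) := fun i =>
    ContMDiffOn.smul_section_of_tsupport g.contMDiff.contMDiffOn e.open_baseSet hg
      (e.contMDiffOn_localFrame_baseSet ∞ b i)
  let c : Fin (Module.finrank ℝ F) → ∀ x, V x →ₗ[ℝ] ℝ := fun i x =>
    g x • (b.coord i ∘ₗ e.linearMapAt ℝ x)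
  have hc : ∀ i x (hx : x ∈ e.baseSet) (v : V x), c i x v = g x * b.coord i (e ⟨x, v⟩).2 := by
    intro i x hx v
    simp [c, hx]
  refine ⟨_, gs * gs, fun i => ⟨_, hs i⟩, c, ?_, ?_, ?_⟩
  · filter_upwards [g.eventuallyEq_one] with x hx
    have : gs x = 1 := hx
    simp [this]
  · intro i
    have hE : ∀ u : TotalSpace F V, u.1 ∈ e.baseSet →
        ContMDiffAt (I.prod 𝓘(ℝ, F)) 𝓘(ℝ, ℝ) ∞ (fun u : TotalSpace F V => c i u.1 u.2) u := by
      intro u hu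
      have h1 : ContMDiffAt (I.prod 𝓘(ℝ, F)) (I.prod 𝓘(ℝ, F)) ∞ e u :=
        (Trivialization.contMDiffOn (IB := I) (n := ∞) e).contMDiffAt (e.open_source.mem_nhds (e.mem_source.2 hu))
      have h2 : ContMDiffAt (I.prod 𝓘(ℝ, F)) 𝓘(ℝ, ℝ) ∞
          (fun u : TotalSpace F V => b.coord i (e u).2) u := by
        have h3 : ContDiff ℝ ∞ (fun y : F => (LinearMap.toContinuousLinearMap (b.coord i)) y) :=
          ContinuousLinearMap.contDiff _
        exact h3.contMDiff.contMDiffAt.comp u (contMDiffAt_snd.comp u h1)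
      have h4 : ContMDiffAt (I.prod 𝓘(ℝ, F)) 𝓘(ℝ, ℝ) ∞ (fun u : TotalSpace F V => g u.1) u :=
        g.contMDiff.contMDiffAt.comp u (contMDiffAt_proj V)
      refine (h4.mul h2).congr_of_eventuallyEq ?_
      have : e.source ∈ 𝓝 u := e.open_source.mem_nhds (e.mem_source.2 hu)
      filter_upwards [this] with w hw
      exact hc i w.1 (e.mem_source.1 hw) w.2
    intro u
    by_cases hu : u.1 ∈ tsupport g
    · exact hE u (hg hu)
    · have : ∀ᶠ w : TotalSpace F V in 𝓝 u, c i w.1 w.2 = 0 := by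
        have h5 : ∀ᶠ x in 𝓝 u.1, g x = 0 := by
          filter_upwards [(isClosed_tsupport g).isOpen_compl.mem_nhds hu] with x hx
          exact image_eq_zero_of_notMem_tsupport hx
        have h6 : Filter.Tendsto (TotalSpace.proj : TotalSpace F V → N) (𝓝 u) (𝓝 u.1) :=
          (FiberBundle.continuous_proj F V).continuousAt
        filter_upwards [h6.eventually h5] with w hw
        change g w.1 = 0 at hw
        simp [c, hw]
      exact (contMDiffAt_const (c := (0 : ℝ))).congr_of_eventuallyEq this
  · intro x v
    by_cases hx : x ∈ e.baseSet
    · have h7 : v = ∑ i, b.coord i (e ⟨x, v⟩).2 • e.localFrame b i x := by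
        apply (e.linearEquivAt ℝ x hx).injective
        simp only [map_sum, map_smul]
        have : ∀ i, e.linearEquivAt ℝ x hx (e.localFrame b i x) = b i := by
          intro i
          simp [Trivialization.localFrame, hx, Trivialization.basisAt]
        simp only [this, Module.Basis.coord_apply]
        rw [b.sum_repr]; rfl
      have h8 : ∑ i, c i x v • (g x • e.localFrame b i x) =
          (g x * g x) • ∑ i, b.coord i (e ⟨x, v⟩).2 • e.localFrame b i x := by
        rw [Finset.smul_sum]
        refine Finset.sum_congr rfl fun i _ => ?_
        rw [hc i x hx, smul_smul, smul_smul]; ring_nf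
      rw [← h7] at h8
      exact h8.symm
    · have h9 : g x = 0 := image_eq_zero_of_notMem_tsupport fun h => hx (hg h)
      change (g x * g x) • v = _
      simp [c, h9]

/-- A linear right inverse of the evaluation of smooth sections at a point. -/
theorem exists_section_extension (I : ModelWithCorners ℝ E H) [IsManifold I ∞ N]
    [ContMDiffVectorBundle ∞ F V I] (x : N) :
    ∃ ε : V x →ₗ[ℝ] Cₛ^∞⟮I; F, V⟯, ∀ v, ε v x = v := by
  obtain ⟨r, χ, s, c, hχ, -, h⟩ := exists_cutoff_frame (F := F) (V := V) I x
  refine ⟨∑ i, (c i x).smulRight (s i), fun v => ?_⟩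
  have h1 := h x v
  rw [hχ.self_of_nhds, one_smul] at h1
  rw [LinearMap.sum_apply]
  refine Eq.trans ?_ h1.symm
  rw [ContMDiffSection.sum_apply']
  rfl

/-- The value at `x` of an endomorphism `φ` of the module of sections: the endomorphism of the
fibre `V x` sending `s(x)` to `(φ s)(x)`. -/
def fibreEnd (φ : Module.End C^∞⟮I, N; 𝓘(ℝ, ℝ), ℝ⟯ Cₛ^∞⟮I; F, V⟯) (x : N) : V x →ₗ[ℝ] V x where
  toFun v := φ ((exists_section_extension (F := F) (V := V) I x).choose v) x
  map_add' v w := by simp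
  map_smul' a v := by
    have := LinearMap.map_smul_of_tower φ a
      ((exists_section_extension (F := F) (V := V) I x).choose v)
    simp [this]

theorem cutoff_frame_sections {r : ℕ} {χ : C^∞⟮I, N; 𝓘(ℝ, ℝ), ℝ⟯} {s : Fin r → Cₛ^∞⟮I; F, V⟯}
    {c : Fin r → ∀ x, V x →ₗ[ℝ] ℝ}
    (hc : ∀ i, ContMDiff (I.prod 𝓘(ℝ, F)) 𝓘(ℝ, ℝ) ∞ (fun u : TotalSpace F V => c i u.1 u.2))
    (h : ∀ x (v : V x), χ x • v = ∑ i, c i x v • s i x) (σ : Cₛ^∞⟮I; F, V⟯) :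
    χ • σ = ∑ i, smoothFun (fun x => c i x (σ x)) ((hc i).comp σ.contMDiff) • s i := by
  ext x
  rw [ContMDiffSection.sum_apply']
  exact h x (σ x)

/-- The defining property of `fibreEnd`. -/
theorem fibreEnd_apply (φ : Module.End C^∞⟮I, N; 𝓘(ℝ, ℝ), ℝ⟯ Cₛ^∞⟮I; F, V⟯) (x : N)
    (σ : Cₛ^∞⟮I; F, V⟯) : fibreEnd φ x (σ x) = φ σ x := by
  obtain ⟨r, χ, s, c, hχ, hc, h⟩ := exists_cutoff_frame (F := F) (V := V) I x
  have key : ∀ τ : Cₛ^∞⟮I; F, V⟯, φ τ x = ∑ i, c i x (τ x) • φ (s i) x := by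
    intro τ
    have h1 := congrArg (fun τ => φ τ x) (cutoff_frame_sections hc h τ)
    simp only [map_smul, map_sum, ContMDiffSection.sum_apply',
      ContMDiffSection.smooth_smul_apply, hχ.self_of_nhds, one_smul] at h1
    simpa using h1
  change φ _ x = φ σ x
  rw [key, key σ, (exists_section_extension (F := F) (V := V) I x).choose_spec]

/-- The fibrewise trace `Tr : Γ(End V) → C^∞(N)`, where sections of `End V` are the endomorphisms of
the `C^∞(N)`-module of sections of `V`. -/
def smoothTrace : Module.End C^∞⟮I, N; 𝓘(ℝ, ℝ), ℝ⟯ Cₛ^∞⟮I; F, V⟯ →ₗ[C^∞⟮I, N; 𝓘(ℝ, ℝ), ℝ⟯]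
    C^∞⟮I, N; 𝓘(ℝ, ℝ), ℝ⟯ where
  toFun φ := ⟨fun x => LinearMap.trace ℝ (V x) (fibreEnd φ x), by
    intro x₀
    obtain ⟨r, χ, s, c, hχ, hc, h⟩ := exists_cutoff_frame (F := F) (V := V) I x₀
    have h1 : ContMDiffAt I 𝓘(ℝ, ℝ) ∞ (fun x => ∑ i, c i x (φ (s i) x)) x₀ :=
      ContMDiffAt.sum fun i _ => ((hc i).comp (φ (s i)).contMDiff).contMDiffAt
    refine h1.congr_of_eventuallyEq (hχ.mono fun x hx => ?_)
    beta_reduce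
    have : FiniteDimensional ℝ (V x) := VectorBundle.finiteDimensional ℝ F V x
    have h2 : fibreEnd φ x = ∑ i, (c i x).smulRight (φ (s i) x) := by
      ext v
      have h3 := h x v
      rw [hx, one_smul] at h3
      conv_lhs => rw [h3]
      simp [fibreEnd_apply]
    rw [h2, map_sum]
    simp [LinearMap.trace_smulRight]⟩
  map_add' φ ψ := by
    ext x
    have : fibreEnd (φ + ψ) x = fibreEnd φ x + fibreEnd ψ x := by
      ext v; simp [fibreEnd]
    change LinearMap.trace ℝ (V x) (fibreEnd (φ + ψ) x) =
      LinearMap.trace ℝ (V x) (fibreEnd φ x) + LinearMap.trace ℝ (V x) (fibreEnd ψ x)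
    rw [this, map_add]
  map_smul' f φ := by
    ext x
    have : fibreEnd (f • φ) x = f x • fibreEnd φ x := by
      ext v; simp [fibreEnd]
    change LinearMap.trace ℝ (V x) (fibreEnd (f • φ) x) = f x * LinearMap.trace ℝ (V x) (fibreEnd φ x)
    rw [this, map_smul, smul_eq_mul]

@[simp] theorem smoothTrace_apply (φ : Module.End C^∞⟮I, N; 𝓘(ℝ, ℝ), ℝ⟯ Cₛ^∞⟮I; F, V⟯) (x : N) :
    smoothTrace φ x = LinearMap.trace ℝ (V x) (fibreEnd φ x) := rfl

end Generic

section Algebraic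

variable {L : Type*} [LieRing L] [LieAlgebra ℝ L]

/-- The second sum of the Koszul formula,
`∑_{i<j} (-1)^{i+j} η([a_i, a_j], a_0, …, â_i, …, â_j, …, a_n)`, as an alternating map; there is
no such term when `η` has degree `0`. -/
def koszulBracketTerm {W : Type*} [AddCommGroup W] [Module ℝ W] :
    ∀ {n : ℕ}, (L [⋀^Fin n]→ₗ[ℝ] W) → (L [⋀^Fin (n + 1)]→ₗ[ℝ] W)
  | 0, _ => 0
  | _ + 1, η => (-(1 / 2) : ℝ) • AlternatingMap.alternatizeUncurryFin
      (AlternatingMap.alternatizeUncurryFinLM ∘ₗ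
        ((LieModule.toEnd ℝ L L : L →ₗ[ℝ] L →ₗ[ℝ] L).compr₂ η.curryLeft))

theorem koszulBracketTerm_apply {W : Type*} [AddCommGroup W] [Module ℝ W] {n : ℕ}
    (η : L [⋀^Fin (n + 1)]→ₗ[ℝ] W) (a : Fin (n + 2) → L) :
    koszulBracketTerm η a = ∑ i : Fin (n + 1), ∑ j ≥ i,
      (-1 : ℝ) ^ ((i.castSucc : ℕ) + (j.succ : ℕ)) •
        η (Matrix.vecCons ⁅a i.castSucc, a j.succ⁆ (j.removeNth (i.castSucc.removeNth a))) := by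
  simp only [koszulBracketTerm, AlternatingMap.smul_apply]
  rw [AlternatingMap.alternatizeUncurryFin_alternatizeUncurryFinLM_comp_apply, Finset.smul_sum]
  refine Finset.sum_congr rfl fun i _ => ?_
  rw [Finset.smul_sum]
  refine Finset.sum_congr rfl fun j _ => ?_
  simp only [LinearMap.compr₂_apply, LieHom.coe_toLinearMap, LieModule.toEnd_apply_apply,
    AlternatingMap.curryLeft_apply_apply]
  rw [← lie_skew (a i.castSucc) (a j.succ)]
  set b := ⁅a j.succ, a i.castSucc⁆
  have h : η (Matrix.vecCons (-b) (j.removeNth (i.castSucc.removeNth a))) =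
      - η (Matrix.vecCons b (j.removeNth (i.castSucc.removeNth a))) := by
    have := (η.curryLeft).map_neg b
    exact congrArg (fun f => f (j.removeNth (i.castSucc.removeNth a))) this
  rw [h]
  rw [Int.cast_smul_eq_zsmul ℝ _ _ |>.symm]
  simp only [Fin.val_castSucc, Fin.val_succ]
  rw [← neg_add', ← two_smul ℝ, smul_neg, smul_neg, smul_neg, smul_smul, smul_smul]
  congr 2
  push_cast
  ring

/-- The map `a ↦ D_a ∘ η`. -/
def koszulAction {W : Type*} [AddCommGroup W] [Module ℝ W] (D : L →ₗ[ℝ] Module.End ℝ W)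
    {n : ℕ} (η : L [⋀^Fin n]→ₗ[ℝ] W) : L →ₗ[ℝ] L [⋀^Fin n]→ₗ[ℝ] W where
  toFun a := (D a).compAlternatingMap η
  map_add' a b := by ext v; simp
  map_smul' c a := by ext v; simp

/-- The Koszul differential
`(d η)(a_0, …, a_n) = ∑_i (-1)^i D_{a_i}(η(a_0, …, â_i, …, a_n))
  + ∑_{i<j} (-1)^{i+j} η([a_i, a_j], a_0, …, â_i, …, â_j, …, a_n)`
of `ℝ`-multilinear alternating forms on a Lie algebra `L` with values in a real vector space `W`
on which `L` acts by linear operators `D_a`. -/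
def koszulDifferential {W : Type*} [AddCommGroup W] [Module ℝ W] (D : L →ₗ[ℝ] Module.End ℝ W)
    (n : ℕ) : (L [⋀^Fin n]→ₗ[ℝ] W) →ₗ[ℝ] (L [⋀^Fin (n + 1)]→ₗ[ℝ] W) where
  toFun η := AlternatingMap.alternatizeUncurryFin (koszulAction D η) + koszulBracketTerm η
  map_add' η θ := by
    ext v
    cases n with
    | zero =>
      simp [AlternatingMap.alternatizeUncurryFin_apply, koszulBracketTerm, koszulAction]
    | succ n =>
      simp only [AlternatingMap.add_apply, koszulBracketTerm_apply, AlternatingMap.alternatizeUncurryFin_apply, koszulAction, LinearMap.coe_mk, AddHom.coe_mk, LinearMap.compAlternatingMap_apply, smul_add, map_add, Finset.sum_add_distrib]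
      abel
  map_smul' c η := by
    ext v
    cases n with
    | zero =>
      simp [AlternatingMap.alternatizeUncurryFin_apply, koszulBracketTerm, koszulAction]
    | succ n =>
      simp only [AlternatingMap.add_apply, AlternatingMap.smul_apply, koszulBracketTerm_apply, AlternatingMap.alternatizeUncurryFin_apply, koszulAction, LinearMap.coe_mk, AddHom.coe_mk, LinearMap.compAlternatingMap_apply, smul_add, map_smul, Finset.smul_sum, RingHom.id_apply, smul_comm c]

theorem koszulDifferential_apply {W : Type*} [AddCommGroup W] [Module ℝ W]
    (D : L →ₗ[ℝ] Module.End ℝ W) (n : ℕ) (η : L [⋀^Fin (n + 1)]→ₗ[ℝ] W) (a : Fin (n + 2) → L) :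
    koszulDifferential D (n + 1) η a =
      ∑ i : Fin (n + 2), (-1 : ℝ) ^ (i : ℕ) • D (a i) (η (i.removeNth a)) +
      ∑ i : Fin (n + 1), ∑ j ≥ i, (-1 : ℝ) ^ ((i.castSucc : ℕ) + (j.succ : ℕ)) •
        η (Matrix.vecCons ⁅a i.castSucc, a j.succ⁆ (j.removeNth (i.castSucc.removeNth a))) := by
  rw [← koszulBracketTerm_apply]
  change AlternatingMap.alternatizeUncurryFin (koszulAction D η) a + _ = _
  rw [AlternatingMap.alternatizeUncurryFin_apply]
  congr 1
  refine Finset.sum_congr rfl fun i _ => ?_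
  rw [← Int.cast_smul_eq_zsmul ℝ]
  push_cast
  rfl

theorem koszulDifferential_zero_apply {W : Type*} [AddCommGroup W] [Module ℝ W]
    (D : L →ₗ[ℝ] Module.End ℝ W) (η : L [⋀^Fin 0]→ₗ[ℝ] W) (a : Fin 1 → L) :
    koszulDifferential D 0 η a = D (a 0) (η ![]) := by
  change AlternatingMap.alternatizeUncurryFin (koszulAction D η) a + _ = _
  rw [AlternatingMap.alternatizeUncurryFin_apply]
  refine (add_zero _).trans ((Fin.sum_univ_one _).trans ?_)
  refine (one_smul ℤ _).trans ?_
  exact congrArg (fun v => D (a 0) (η v)) (Subsingleton.elim _ _)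

/-- The space of alternating `ℝ`-multilinear `k`-forms on `L` with values in `W`. -/
abbrev AltForm (L : Type*) [LieRing L] [LieAlgebra ℝ L] (W : Type*) [AddCommGroup W] [Module ℝ W]
    (k : ℕ) : Type _ := L [⋀^Fin k]→ₗ[ℝ] W

section Cohomology

variable {W : Type*} [AddCommGroup W] [Module ℝ W] (D : L →ₗ[ℝ] Module.End ℝ W)

/-- Closed forms of degree `k`. -/
def koszulCocycles (k : ℕ) : Submodule ℝ (AltForm L W k) := LinearMap.ker (koszulDifferential D k)

/-- Exact forms of degree `k`. -/
def koszulCoboundaries : ∀ k : ℕ, Submodule ℝ (AltForm L W k)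
  | 0 => ⊥
  | k + 1 => LinearMap.range (koszulDifferential D k)

/-- Closed forms of degree `k` modulo exact forms. -/
abbrev KoszulCohomology (k : ℕ) : Type _ :=
  koszulCocycles D k ⧸ (koszulCoboundaries D k).submoduleOf (koszulCocycles D k)

/-- The cohomology class of a closed form. -/
def koszulClass {k : ℕ} (η : AltForm L W k) (hη : koszulDifferential D k η = 0) :
    KoszulCohomology D k :=
  Submodule.Quotient.mk ⟨η, hη⟩

end Cohomology

/-- For a bilinear map `K` with values in an algebra, the multilinear map
`(a_1, …, a_{2p}) ↦ K(a_1, a_2) K(a_3, a_4) ⋯ K(a_{2p-1}, a_{2p})`. -/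
def pairProduct {B : Type*} [Ring B] [Algebra ℝ B] (K : L →ₗ[ℝ] L →ₗ[ℝ] B) (p : ℕ) :
    MultilinearMap ℝ (fun _ : Fin (2 * p) => L) B :=
  have key : ∀ [DecidableEq (Fin (2 * p))] (a : Fin (2 * p) → L) (k : Fin (2 * p)),
      ∃ (j : Fin p) (ℓ : L →ₗ[ℝ] B), ∀ x,
        (fun i : Fin p => K (Function.update a k x ⟨2 * i, by omega⟩)
          (Function.update a k x ⟨2 * i + 1, by omega⟩)) =
        Function.update (fun i : Fin p => K (a ⟨2 * i, by omega⟩) (a ⟨2 * i + 1, by omega⟩))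
          j (ℓ x) := by
    intro _ a k
    have hk := k.2
    by_cases h : (k : ℕ) % 2 = 0
    · refine ⟨⟨k / 2, by omega⟩, K.flip (a ⟨k + 1, by omega⟩), fun x => ?_⟩
      funext i
      by_cases hi : i = ⟨k / 2, by omega⟩
      · subst hi
        have h1 : (⟨2 * (k / 2), by omega⟩ : Fin (2 * p)) = k := Fin.ext (by simp; omega)
        have h2 : (⟨2 * (k / 2) + 1, by omega⟩ : Fin (2 * p)) = ⟨k + 1, by omega⟩ :=
          Fin.ext (by simp; omega)
        have h3 : (⟨k + 1, by omega⟩ : Fin (2 * p)) ≠ k := fun h => by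
          have := congrArg Fin.val h; simp at this
        simp [h1, h2, h3]
      · have hi' : (i : ℕ) ≠ k / 2 := fun h => hi (Fin.ext h)
        have h1 : (⟨2 * i, by omega⟩ : Fin (2 * p)) ≠ k := fun h => by
          have := congrArg Fin.val h; simp at this; omega
        have h2 : (⟨2 * i + 1, by omega⟩ : Fin (2 * p)) ≠ k := fun h => by
          have := congrArg Fin.val h; simp at this; omega
        simp [h1, h2, hi]
    · refine ⟨⟨k / 2, by omega⟩, K (a ⟨k - 1, by omega⟩), fun x => ?_⟩
      funext i
      by_cases hi : i = ⟨k / 2, by omega⟩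
      · subst hi
        have h1 : (⟨2 * (k / 2) + 1, by omega⟩ : Fin (2 * p)) = k := Fin.ext (by simp; omega)
        have h2 : (⟨2 * (k / 2), by omega⟩ : Fin (2 * p)) = ⟨k - 1, by omega⟩ :=
          Fin.ext (by simp; omega)
        have h3 : (⟨k - 1, by omega⟩ : Fin (2 * p)) ≠ k := fun h => by
          have := congrArg Fin.val h; simp at this; omega
        simp [h1, h2, h3]
      · have hi' : (i : ℕ) ≠ k / 2 := fun h => hi (Fin.ext h)
        have h1 : (⟨2 * i, by omega⟩ : Fin (2 * p)) ≠ k := fun h => by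
          have := congrArg Fin.val h; simp at this; omega
        have h2 : (⟨2 * i + 1, by omega⟩ : Fin (2 * p)) ≠ k := fun h => by
          have := congrArg Fin.val h; simp at this; omega
        simp [h1, h2, hi]
  { toFun := fun a =>
      (List.ofFn fun i : Fin p => K (a ⟨2 * i, by omega⟩) (a ⟨2 * i + 1, by omega⟩)).prod
    map_update_add' := fun a k x y => by
      obtain ⟨j, ℓ, h⟩ := key a k
      simp only [h, map_add]
      exact (MultilinearMap.mkPiAlgebraFin ℝ p B).map_update_add _ j (ℓ x) (ℓ y)
    map_update_smul' := fun a k c x => by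
      obtain ⟨j, ℓ, h⟩ := key a k
      simp only [h, map_smul]
      exact (MultilinearMap.mkPiAlgebraFin ℝ p B).map_update_smul _ j c (ℓ x) }

/-- `K^p(a_1, …, a_{2p}) = 2^{-p} ∑_{τ ∈ S_{2p}} sgn τ · K(a_{τ(1)}, a_{τ(2)}) ⋯
K(a_{τ(2p-1)}, a_{τ(2p)})`. -/
def alternatingPower {B : Type*} [Ring B] [Algebra ℝ B] (K : L →ₗ[ℝ] L →ₗ[ℝ] B) (p : ℕ) :
    L [⋀^Fin (2 * p)]→ₗ[ℝ] B :=
  (1 / 2 ^ p : ℝ) • MultilinearMap.alternatization (pairProduct K p)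

theorem alternatingPower_apply {B : Type*} [Ring B] [Algebra ℝ B] (K : L →ₗ[ℝ] L →ₗ[ℝ] B) (p : ℕ)
    (a : Fin (2 * p) → L) :
    alternatingPower K p a = (1 / 2 ^ p : ℝ) • ∑ τ : Equiv.Perm (Fin (2 * p)),
      (Equiv.Perm.sign τ : ℤ) • (List.ofFn fun i : Fin p =>
        K (a (τ ⟨2 * i, by omega⟩)) (a (τ ⟨2 * i + 1, by omega⟩))).prod := by
  simp only [alternatingPower, AlternatingMap.smul_apply, MultilinearMap.alternatization_apply]
  rfl

variable {R : Type*} [CommRing R] [Algebra ℝ R]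

/-- An `ℝ`-linear connection, on a module `W` over an algebra `R`, of a Lie algebra `L` acting on
`R` by derivations through `δ`: an `ℝ`-linear assignment `a ↦ ∇_a` of `ℝ`-linear operators on `W`
with `∇_a (f w) = f ∇_a w + δ_a(f) w`. No `R`-linearity in `a` is required. -/
structure RLinearConnection (δ : L →ₗ⁅ℝ⁆ Derivation ℝ R R) (W : Type*) [AddCommGroup W]
    [Module ℝ W] [Module R W] where
  toLinearMap : L →ₗ[ℝ] Module.End ℝ W
  leibniz : ∀ (a : L) (f : R) (w : W),
    toLinearMap a (f • w) = f • toLinearMap a w + δ a f • w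

namespace RLinearConnection

variable {δ : L →ₗ⁅ℝ⁆ Derivation ℝ R R} {W : Type*} [AddCommGroup W]
  [Module ℝ W] [Module R W] [IsScalarTower ℝ R W]

instance : CoeFun (RLinearConnection δ W) (fun _ => L → Module.End ℝ W) :=
  ⟨fun D => D.toLinearMap⟩

/-- The curvature `R_{a,b} = ∇_a ∘ ∇_b - ∇_b ∘ ∇_a - ∇_{[a,b]}`, an `R`-linear endomorphism. -/
def curvature (D : RLinearConnection δ W) : L →ₗ[ℝ] L →ₗ[ℝ] Module.End R W :=
  LinearMap.mk₂ ℝ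
    (fun a b =>
      { toFun := fun w => D a (D b w) - D b (D a w) - D ⁅a, b⁆ w
        map_add' := fun v w => by simp only [map_add]; abel
        map_smul' := fun f w => by
          simp only [D.leibniz, map_add, LieHom.map_lie, Derivation.commutator_apply, sub_smul, smul_sub, RingHom.id_apply]
          abel })
    (fun a a' b => by ext w; simp; abel)
    (fun c a b => by ext w; simp [smul_sub])
    (fun a b b' => by ext w; simp; abel)
    (fun c a b => by ext w; simp [smul_sub])

@[simp] theorem curvature_apply (D : RLinearConnection δ W) (a b : L) (w : W) :
    D.curvature a b w = D a (D b w) - D b (D a w) - D ⁅a, b⁆ w := rfl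

end RLinearConnection
end Algebraic

section Algebroid

/-- A Lie algebroid structure on a smooth vector bundle `A → M`: an anchor, which is a smooth
homomorphism of vector bundles `A → TM`, and an `ℝ`-Lie algebra structure on the space of smooth
sections of `A`, related by the Leibniz identity. -/
structure LieAlgebroid (n : ℕ) {M : Type*} [TopologicalSpace M]
    [ChartedSpace (EuclideanSpace ℝ (Fin n)) M] [IsManifold (𝓡 n) ∞ M]
    (FA : Type*) [NormedAddCommGroup FA] [NormedSpace ℝ FA]
    (A : M → Type*) [TopologicalSpace (TotalSpace FA A)] [∀ x, AddCommGroup (A x)]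
    [∀ x, Module ℝ (A x)] [∀ x, TopologicalSpace (A x)] [FiberBundle FA A]
    [VectorBundle ℝ FA A] where
  anchor : ∀ x, A x →ₗ[ℝ] TangentSpace (𝓡 n) x
  contMDiff_anchor : ContMDiff ((𝓡 n).prod 𝓘(ℝ, FA)) (𝓡 n).tangent ∞
    (fun v : TotalSpace FA A => (⟨v.1, anchor v.1 v.2⟩ : TangentBundle (𝓡 n) M))
  bracket : Cₛ^∞⟮𝓡 n; FA, A⟯ →ₗ[ℝ] Cₛ^∞⟮𝓡 n; FA, A⟯ →ₗ[ℝ] Cₛ^∞⟮𝓡 n; FA, A⟯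
  bracket_self : ∀ a, bracket a a = 0
  jacobi : ∀ a b c,
    bracket a (bracket b c) + bracket b (bracket c a) + bracket c (bracket a b) = 0
  leibniz : ∀ (a b : Cₛ^∞⟮𝓡 n; FA, A⟯) (f : C^∞⟮𝓡 n, M; 𝓘(ℝ, ℝ), ℝ⟯),
    bracket a (f • b) = f • bracket a b + vectorFieldDerivation
      ⟨fun x => anchor x (a x), contMDiff_anchor.comp a.contMDiff⟩ f • b

variable {n : ℕ} {M : Type*} [TopologicalSpace M]
  [ChartedSpace (EuclideanSpace ℝ (Fin n)) M] [IsManifold (𝓡 n) ∞ M]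
  {FA : Type*} [NormedAddCommGroup FA] [NormedSpace ℝ FA]
  {A : M → Type*} [TopologicalSpace (TotalSpace FA A)] [∀ x, AddCommGroup (A x)]
  [∀ x, Module ℝ (A x)] [∀ x, TopologicalSpace (A x)] [FiberBundle FA A]
  [VectorBundle ℝ FA A]

namespace LieAlgebroid

/-- The Lie algebra `Γ(A)` of smooth sections of a Lie algebroid. -/
def Sec (_ : LieAlgebroid n FA A) : Type _ := Cₛ^∞⟮𝓡 n; FA, A⟯

variable (𝒜 : LieAlgebroid n FA A)

instance : AddCommGroup 𝒜.Sec := inferInstanceAs (AddCommGroup Cₛ^∞⟮𝓡 n; FA, A⟯)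
instance : Module ℝ 𝒜.Sec := inferInstanceAs (Module ℝ Cₛ^∞⟮𝓡 n; FA, A⟯)
instance : Module C^∞⟮𝓡 n, M; 𝓘(ℝ, ℝ), ℝ⟯ 𝒜.Sec :=
  inferInstanceAs (Module C^∞⟮𝓡 n, M; 𝓘(ℝ, ℝ), ℝ⟯ Cₛ^∞⟮𝓡 n; FA, A⟯)

theorem bracket_skew (a b : Cₛ^∞⟮𝓡 n; FA, A⟯) : 𝒜.bracket a b = - 𝒜.bracket b a := by
  have h := 𝒜.bracket_self (a + b)
  simp only [map_add, LinearMap.add_apply, 𝒜.bracket_self, zero_add, add_zero] at h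
  exact eq_neg_of_add_eq_zero_left (by rwa [add_comm] at h)

instance : LieRing 𝒜.Sec where
  bracket a b := 𝒜.bracket a b
  add_lie a b c :=
    (congrArg (fun f => f c) (𝒜.bracket.map_add a b))
  lie_add a b c := (𝒜.bracket a).map_add b c
  lie_self a := 𝒜.bracket_self a
  leibniz_lie a b c := by
    have h := 𝒜.jacobi a b c
    have h1 : 𝒜.bracket b (𝒜.bracket c a) = - 𝒜.bracket b (𝒜.bracket a c) := by
      rw [𝒜.bracket_skew c a, map_neg]
    have h2 : 𝒜.bracket c (𝒜.bracket a b) = - 𝒜.bracket (𝒜.bracket a b) c :=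
      𝒜.bracket_skew _ _
    change 𝒜.bracket a (𝒜.bracket b c) = 𝒜.bracket (𝒜.bracket a b) c +
      𝒜.bracket b (𝒜.bracket a c)
    rw [h1, h2] at h
    rw [← sub_eq_zero, ← h]
    abel

instance : LieAlgebra ℝ 𝒜.Sec where
  lie_smul c a b := (𝒜.bracket a).map_smul c b

/-- The vector field `ρ_A ∘ a`. -/
def anchorField : 𝒜.Sec →ₗ[ℝ] Cₛ^∞⟮𝓡 n; EuclideanSpace ℝ (Fin n),
    (TangentSpace (𝓡 n) : M → Type _)⟯ where
  toFun a := ⟨fun x => 𝒜.anchor x ((show Cₛ^∞⟮𝓡 n; FA, A⟯ from a) x),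
    𝒜.contMDiff_anchor.comp (show Cₛ^∞⟮𝓡 n; FA, A⟯ from a).contMDiff⟩
  map_add' _ _ := ContMDiffSection.ext fun x => (𝒜.anchor x).map_add _ _
  map_smul' c _ := ContMDiffSection.ext fun x => (𝒜.anchor x).map_smul c _

variable [T2Space M] [FiniteDimensional ℝ FA] [ContMDiffVectorBundle ∞ FA A (𝓡 n)]

/-- The action of sections of `A` on smooth functions, `a ↦ (f ↦ (ρ_A ∘ a)(f))`; it is a
homomorphism of Lie algebras. -/
def anchorDerivation : 𝒜.Sec →ₗ⁅ℝ⁆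
    Derivation ℝ C^∞⟮𝓡 n, M; 𝓘(ℝ, ℝ), ℝ⟯ C^∞⟮𝓡 n, M; 𝓘(ℝ, ℝ), ℝ⟯ where
  toFun a := vectorFieldDerivation (𝒜.anchorField a)
  map_add' a b := by rw [map_add, vectorFieldDerivation_add]
  map_smul' c a := by rw [map_smul, vectorFieldDerivation_smul]; rfl
  map_lie' {a b} := by
    ext f x
    let δ : 𝒜.Sec → C^∞⟮𝓡 n, M; 𝓘(ℝ, ℝ), ℝ⟯ → C^∞⟮𝓡 n, M; 𝓘(ℝ, ℝ), ℝ⟯ :=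
      fun a => vectorFieldDerivation (𝒜.anchorField a)
    have leib : ∀ (a b : 𝒜.Sec) (f : C^∞⟮𝓡 n, M; 𝓘(ℝ, ℝ), ℝ⟯), ⁅a, f • b⁆ = f • ⁅a, b⁆ + δ a f • b :=
      𝒜.leibniz
    have key : ∀ c : 𝒜.Sec, δ ⁅a, b⁆ f • c = (δ a (δ b f) - δ b (δ a f)) • c := by
      intro c
      have h1 := leib ⁅a, b⁆ c f
      have h2 : ⁅⁅a, b⁆, f • c⁆ = ⁅a, ⁅b, f • c⁆⁆ - ⁅b, ⁅a, f • c⁆⁆ := lie_lie a b (f • c)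
      have h3 : ⁅⁅a, b⁆, c⁆ = ⁅a, ⁅b, c⁆⁆ - ⁅b, ⁅a, c⁆⁆ := lie_lie a b c
      rw [h2, leib b c, leib a c, lie_add, lie_add, leib, leib, leib, leib, h3] at h1
      rw [sub_smul, eq_comm, ← sub_eq_zero]
      rw [← sub_eq_zero] at h1
      rw [← h1, smul_sub]
      abel
    by_cases hs : Subsingleton (A x)
    · have hz : ∀ (c : 𝒜.Sec) (g : C^∞⟮𝓡 n, M; 𝓘(ℝ, ℝ), ℝ⟯), δ c g x = 0 := by
        intro c g
        have h0 : 𝒜.anchorField c x = 0 := by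
          change 𝒜.anchor x ((show Cₛ^∞⟮𝓡 n; FA, A⟯ from c) x) = 0
          rw [Subsingleton.elim ((show Cₛ^∞⟮𝓡 n; FA, A⟯ from c) x) 0, map_zero]
        change mfderiv (𝓡 n) 𝓘(ℝ, ℝ) g x (𝒜.anchorField c x) = (0 : ℝ)
        rw [h0]
        exact map_zero _
      change δ ⁅a, b⁆ f x = δ a (δ b f) x - δ b (δ a f) x
      rw [hz, hz, hz, sub_zero]
    · rw [not_subsingleton_iff_nontrivial] at hs
      obtain ⟨v, hv⟩ := exists_ne (0 : A x)
      obtain ⟨ε, hε⟩ := exists_section_extension (F := FA) (V := A) (𝓡 n) x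
      have h1 : δ ⁅a, b⁆ f x • v = (δ a (δ b f) x - δ b (δ a f) x) • v := by
        have := congrArg (fun c : Cₛ^∞⟮𝓡 n; FA, A⟯ => c x) (key (ε v))
        change δ ⁅a, b⁆ f x • (ε v) x = (δ a (δ b f) x - δ b (δ a f) x) • (ε v) x at this
        rwa [hε] at this
      exact smul_left_injective ℝ hv h1

@[simp] theorem anchorDerivation_apply (a : 𝒜.Sec) :
    𝒜.anchorDerivation a = vectorFieldDerivation (𝒜.anchorField a) := rfl

/-- The action of `Γ(A)` on `C^∞(M)` by linear operators through the anchor. -/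
def anchorAction : 𝒜.Sec →ₗ[ℝ] Module.End ℝ C^∞⟮𝓡 n, M; 𝓘(ℝ, ℝ), ℝ⟯ where
  toFun a := (𝒜.anchorDerivation a : C^∞⟮𝓡 n, M; 𝓘(ℝ, ℝ), ℝ⟯ →ₗ[ℝ] C^∞⟮𝓡 n, M; 𝓘(ℝ, ℝ), ℝ⟯)
  map_add' a b := by rw [map_add]; rfl
  map_smul' c a := by rw [map_smul]; rfl

/-- The space of `ℝ`-linear `k`-forms on `A` with values in `C^∞(M)`: alternating `ℝ`-multilinear
maps `Γ(A)^k → C^∞(M)`. -/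
abbrev Form (k : ℕ) : Type _ := AltForm 𝒜.Sec C^∞⟮𝓡 n, M; 𝓘(ℝ, ℝ), ℝ⟯ k

/-- The differential `d_{A,ℝ}` of `ℝ`-linear forms on `A`, given by the Koszul formula for the
action of `Γ(A)` on `C^∞(M)` through the anchor. -/
def d (k : ℕ) : 𝒜.Form k →ₗ[ℝ] 𝒜.Form (k + 1) := koszulDifferential 𝒜.anchorAction k

/-- The Lie algebroid `ℝ`-cohomology `H^k_{ρ_A,ℝ}(A; M × ℝ)`: closed forms modulo exact forms. -/
abbrev Cohomology (k : ℕ) : Type _ := KoszulCohomology 𝒜.anchorAction k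

/-- The cohomology class of a closed form. -/
def cohomologyClass {k : ℕ} (η : 𝒜.Form k) (hη : 𝒜.d k η = 0) : 𝒜.Cohomology k :=
  koszulClass 𝒜.anchorAction η hη

end LieAlgebroid
end Algebroid

instance Bundle.Pullback.instAddCommGroup {B B' : Type*} (f : B' → B) (V : B → Type*)
    [∀ x, AddCommGroup (V x)] (q : B') : AddCommGroup ((f *ᵖ V) q) :=
  inferInstanceAs (AddCommGroup (V (f q)))

section Cylinder

variable {n : ℕ} {M : Type*} [TopologicalSpace M]
  [ChartedSpace (EuclideanSpace ℝ (Fin n)) M]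

/-- The model with corners of the manifold `ℝ × M`. -/
abbrev cylModel (n : ℕ) : ModelWithCorners ℝ (ℝ × EuclideanSpace ℝ (Fin n))
    (ModelProd ℝ (EuclideanSpace ℝ (Fin n))) := 𝓘(ℝ, ℝ).prod (𝓡 n)

/-- The projection `pr₂ : ℝ × M → M`. -/
abbrev cylProj (n : ℕ) (M : Type*) [TopologicalSpace M]
    [ChartedSpace (EuclideanSpace ℝ (Fin n)) M] : C^∞⟮cylModel n, ℝ × M; 𝓡 n, M⟯ :=
  ContMDiffMap.snd

/-- The coordinate function `t` on `ℝ × M`. -/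
def cylTime : C^∞⟮cylModel n, ℝ × M; 𝓘(ℝ, ℝ), ℝ⟯ := ⟨Prod.fst, contMDiff_fst⟩

@[simp] theorem cylTime_apply (q : ℝ × M) : cylTime (n := n) q = q.1 := rfl

/-- The restriction of a function on `ℝ × M` to `{t} × M`. -/
def cylSlice (t : ℝ) (f : C^∞⟮cylModel n, ℝ × M; 𝓘(ℝ, ℝ), ℝ⟯) : C^∞⟮𝓡 n, M; 𝓘(ℝ, ℝ), ℝ⟯ :=
  ⟨fun x => f (t, x), f.contMDiff.comp (contMDiff_const.prodMk contMDiff_id)⟩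

@[simp] theorem cylSlice_apply (t : ℝ) (f : C^∞⟮cylModel n, ℝ × M; 𝓘(ℝ, ℝ), ℝ⟯) (x : M) :
    cylSlice t f x = f (t, x) := rfl

variable [IsManifold (𝓡 n) ∞ M]

/-- The vector field `r ∂/∂t + X` on `ℝ × M`. -/
def cylField : ℝ × Cₛ^∞⟮𝓡 n; EuclideanSpace ℝ (Fin n), (TangentSpace (𝓡 n) : M → Type _)⟯ →ₗ[ℝ]
    Cₛ^∞⟮cylModel n; ℝ × EuclideanSpace ℝ (Fin n),
      (TangentSpace (cylModel n) : ℝ × M → Type _)⟯ where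
  toFun u := ⟨fun q => ((u.1, u.2 q.2) : ℝ × EuclideanSpace ℝ (Fin n)), by
    have : IsManifold (𝓡 n) 1 M := IsManifold.of_le (n := ∞) (by simp)
    have h1 : ContMDiff (cylModel n) 𝓘(ℝ, ℝ).tangent ∞
        (fun q : ℝ × M => (⟨q.1, u.1⟩ : TangentBundle 𝓘(ℝ, ℝ) ℝ)) := by
      have : ContMDiff 𝓘(ℝ, ℝ) 𝓘(ℝ, ℝ).tangent ∞
          (fun q : ℝ => (⟨q, u.1⟩ : TangentBundle 𝓘(ℝ, ℝ) ℝ)) := by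
        intro x
        exact contMDiffWithinAt_vectorSpace_iff_contDiffWithinAt.2
          (contDiffWithinAt_const)
      exact this.comp contMDiff_fst
    exact (contMDiff_equivTangentBundleProd_symm (I := 𝓘(ℝ, ℝ)) (M := ℝ) (I' := 𝓡 n)
      (M' := M) (n := ∞)).comp (h1.prodMk (u.2.contMDiff.comp contMDiff_snd))⟩
  map_add' u v := rfl
  map_smul' c u := rfl

theorem cylField_derivation_apply (r : ℝ)
    (X : Cₛ^∞⟮𝓡 n; EuclideanSpace ℝ (Fin n), (TangentSpace (𝓡 n) : M → Type _)⟯)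
    (f : C^∞⟮cylModel n, ℝ × M; 𝓘(ℝ, ℝ), ℝ⟯) (t : ℝ) (x : M) :
    vectorFieldDerivation (cylField (r, X)) f (t, x) =
      r * deriv (fun s => f (s, x)) t + vectorFieldDerivation X (cylSlice t f) x := by
  have hf := (f.mdifferentiableAt (x := (t, x)))
  have h := mfderiv_prod_eq_add_apply (v := ((r, X x) : ℝ × EuclideanSpace ℝ (Fin n))) hf
  refine h.trans ?_
  refine congrArg₂ (fun a b : ℝ => a + b) ?_ rfl
  rw [mfderiv_eq_fderiv]
  change fderiv ℝ (fun s => f (s, x)) t r = _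
  rw [← fderiv_apply_one_eq_deriv, ← smul_eq_mul, ← map_smul, smul_eq_mul, mul_one]

/-- Mixed partial derivatives on `ℝ × M` commute. -/
theorem cyl_mixed_partials
    (X : Cₛ^∞⟮𝓡 n; EuclideanSpace ℝ (Fin n), (TangentSpace (𝓡 n) : M → Type _)⟯)
    (f : C^∞⟮cylModel n, ℝ × M; 𝓘(ℝ, ℝ), ℝ⟯) :
    vectorFieldDerivation (cylField (1, 0)) (vectorFieldDerivation (cylField (0, X)) f) =
      vectorFieldDerivation (cylField (0, X)) (vectorFieldDerivation (cylField (1, 0)) f) := by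
  ext ⟨t, x⟩
  have e1 : ∀ (g : C^∞⟮cylModel n, ℝ × M; 𝓘(ℝ, ℝ), ℝ⟯) (s : ℝ) (y : M),
      vectorFieldDerivation (cylField (1, 0)) g (s, y) = deriv (fun s => g (s, y)) s := by
    intro g s y
    rw [cylField_derivation_apply, one_mul]
    have h0 : vectorFieldDerivation 0 (cylSlice s g) y = 0 :=
      (mfderiv (𝓡 n) 𝓘(ℝ, ℝ) (cylSlice s g) y).map_zero
    rw [h0, add_zero]
  have e2 : ∀ (g : C^∞⟮cylModel n, ℝ × M; 𝓘(ℝ, ℝ), ℝ⟯) (s : ℝ) (y : M),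
      vectorFieldDerivation (cylField (0, X)) g (s, y) =
        vectorFieldDerivation X (cylSlice s g) y := by
    intro g s y
    rw [cylField_derivation_apply, zero_mul, zero_add]
  rw [e1, e2]
  simp only [e2]
  -- pass to the chart at `x`
  let φ := extChartAt (𝓡 n) x
  let y₀ := φ x
  let v : EuclideanSpace ℝ (Fin n) := X x
  let G : ℝ × EuclideanSpace ℝ (Fin n) → ℝ := fun q => f (q.1, φ.symm q.2)
  have htgt : φ.target ∈ 𝓝 y₀ := extChartAt_target_mem_nhds x
  have hG : ∀ s : ℝ, ContDiffAt ℝ ∞ G (s, y₀) := by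
    intro s
    have h1 : ContMDiffOn 𝓘(ℝ, EuclideanSpace ℝ (Fin n)) (𝓡 n) ∞ φ.symm φ.target :=
      contMDiffOn_extChartAt_symm x
    have h2 : ContMDiffAt 𝓘(ℝ, EuclideanSpace ℝ (Fin n)) (𝓡 n) ∞ φ.symm y₀ :=
      h1.contMDiffAt htgt
    have h3 : ContMDiffAt (𝓘(ℝ, ℝ).prod 𝓘(ℝ, EuclideanSpace ℝ (Fin n))) (cylModel n) ∞
        (fun q : ℝ × EuclideanSpace ℝ (Fin n) => (q.1, φ.symm q.2)) (s, y₀) :=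
      contMDiffAt_fst.prodMk (ContMDiffAt.comp (s, y₀) h2 contMDiffAt_snd)
    have h4 : ContMDiffAt (𝓘(ℝ, ℝ).prod 𝓘(ℝ, EuclideanSpace ℝ (Fin n))) 𝓘(ℝ, ℝ) ∞ G (s, y₀) :=
      f.contMDiff.contMDiffAt.comp (s, y₀) h3
    rw [← modelWithCornersSelf_prod, chartedSpaceSelf_prod] at h4
    exact h4.contDiffAt
  have hM : ∀ g : C^∞⟮𝓡 n, M; 𝓘(ℝ, ℝ), ℝ⟯,
      vectorFieldDerivation X g x = fderiv ℝ (fun y => g (φ.symm y)) y₀ v := by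
    intro g
    have h := (g.mdifferentiableAt (x := x)).mfderiv
    refine (congrArg (fun L => L (X x)) h).trans ?_
    change fderivWithin ℝ (fun y => g (φ.symm y)) (Set.range (𝓡 n)) y₀ v = _
    rw [ModelWithCorners.range_eq_univ, fderivWithin_univ]
  have hd : ∀ s : ℝ, DifferentiableAt ℝ G (s, y₀) := fun s => (hG s).differentiableAt (by simp)
  have hG' : ContDiffAt ℝ ∞ (fderiv ℝ G) (t, y₀) := (hG t).fderiv_right (by simp)
  have hd2 : DifferentiableAt ℝ (fderiv ℝ G) (t, y₀) := hG'.differentiableAt (by simp)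
  have hsymm : IsSymmSndFDerivAt ℝ G (t, y₀) :=
    (hG t).isSymmSndFDerivAt (by simpa using (mod_cast (le_top : (2 : ℕ∞) ≤ ⊤) : ((2 : ℕ∞) : WithTop ℕ∞) ≤ ((⊤ : ℕ∞) : WithTop ℕ∞)))
  -- left-hand side
  have L1 : (fun s => vectorFieldDerivation X (cylSlice s f) x) =
      fun s => fderiv ℝ G (s, y₀) (0, v) := by
    funext s
    rw [hM]
    have h5 : HasFDerivAt (fun y : EuclideanSpace ℝ (Fin n) => (s, y))
        (ContinuousLinearMap.inr ℝ ℝ (EuclideanSpace ℝ (Fin n))) y₀ := hasFDerivAt_prodMk_right s y₀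
    have h6 := (hd s).hasFDerivAt.comp y₀ h5
    change fderiv ℝ (G ∘ fun y => (s, y)) y₀ v = _
    rw [h6.fderiv]
    simp
  have L2 : HasDerivAt (fun s : ℝ => fderiv ℝ G (s, y₀) (0, v))
      (fderiv ℝ (fderiv ℝ G) (t, y₀) (1, 0) (0, v)) t := by
    have h7 : HasDerivAt (fun s : ℝ => (s, y₀)) ((1 : ℝ), (0 : EuclideanSpace ℝ (Fin n))) t :=
      (hasDerivAt_id t).prodMk (hasDerivAt_const t y₀)
    have h8 := hd2.hasFDerivAt.comp_hasDerivAt t h7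
    have h9 := h8.clm_apply (hasDerivAt_const t ((0 : ℝ), v))
    simpa using h9
  -- right-hand side
  have R1 : ∀ᶠ y in 𝓝 y₀, cylSlice t (vectorFieldDerivation (cylField (1, 0)) f) (φ.symm y) =
      fderiv ℝ G (t, y) (1, 0) := by
    have h10 : ∀ᶠ q in 𝓝 (t, y₀), DifferentiableAt ℝ G q :=
      (((hG t).of_le (m := 1) (by simp)).eventually (by simp)).mono fun q hq => hq.differentiableAt (by simp)
    have h11 : Filter.Tendsto (fun y : EuclideanSpace ℝ (Fin n) => (t, y)) (𝓝 y₀) (𝓝 (t, y₀)) :=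
      (Continuous.prodMk_right t).continuousAt
    filter_upwards [h11.eventually h10] with y hy
    rw [cylSlice_apply, e1]
    have h7 : HasDerivAt (fun s : ℝ => (s, y)) ((1 : ℝ), (0 : EuclideanSpace ℝ (Fin n))) t :=
      (hasDerivAt_id t).prodMk (hasDerivAt_const t y)
    exact (hy.hasFDerivAt.comp_hasDerivAt t h7).deriv
  have R2 : HasFDerivAt (fun y => fderiv ℝ G (t, y) (1, 0))
      ((ContinuousLinearMap.apply ℝ ℝ ((1 : ℝ), (0 : EuclideanSpace ℝ (Fin n)))).comp
        ((fderiv ℝ (fderiv ℝ G) (t, y₀)).comp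
        (ContinuousLinearMap.inr ℝ ℝ (EuclideanSpace ℝ (Fin n))))) y₀ := by
    have h5 : HasFDerivAt (fun y : EuclideanSpace ℝ (Fin n) => (t, y))
        (ContinuousLinearMap.inr ℝ ℝ (EuclideanSpace ℝ (Fin n))) y₀ := hasFDerivAt_prodMk_right t y₀
    exact (ContinuousLinearMap.apply ℝ ℝ ((1 : ℝ), (0 : EuclideanSpace ℝ (Fin n)))).hasFDerivAt.comp
      y₀ (hd2.hasFDerivAt.comp y₀ h5)
  rw [L1, L2.deriv, hM, Filter.EventuallyEq.fderiv_eq R1, R2.fderiv]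
  simpa using hsymm (1, 0) (0, v)

end Cylinder

section CylinderSections

variable {n : ℕ} {M : Type*} [TopologicalSpace M]
  [ChartedSpace (EuclideanSpace ℝ (Fin n)) M]
  {F : Type*} [NormedAddCommGroup F] [NormedSpace ℝ F]
  {V : M → Type*} [TopologicalSpace (TotalSpace F V)] [∀ x, AddCommGroup (V x)]
  [∀ x, Module ℝ (V x)] [∀ x, TopologicalSpace (V x)] [FiberBundle F V] [VectorBundle ℝ F V]

/-- The space `Γ(pr₂^* V)` of smooth sections of the pullback of `V → M` to `ℝ × M`. -/
abbrev CylSection (n : ℕ) {M : Type*} [TopologicalSpace M]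
    [ChartedSpace (EuclideanSpace ℝ (Fin n)) M]
    (F : Type*) [NormedAddCommGroup F] [NormedSpace ℝ F]
    (V : M → Type*) [TopologicalSpace (TotalSpace F V)] [∀ x, AddCommGroup (V x)]
    [∀ x, Module ℝ (V x)] [∀ x, TopologicalSpace (V x)] [FiberBundle F V] [VectorBundle ℝ F V] :
    Type _ :=
  Cₛ^∞⟮cylModel n; F, (cylProj n M *ᵖ V)⟯

theorem contMDiffAt_cylSection_iff (σ : ∀ q : ℝ × M, V q.2) (q₀ : ℝ × M) :
    ContMDiffAt (cylModel n) ((cylModel n).prod 𝓘(ℝ, F)) ∞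
      (fun q => (⟨q, σ q⟩ : TotalSpace F (cylProj n M *ᵖ V))) q₀ ↔
    ContMDiffAt (cylModel n) ((𝓡 n).prod 𝓘(ℝ, F)) ∞
      (fun q => (⟨q.2, σ q⟩ : TotalSpace F V)) q₀ := by
  rw [contMDiffAt_totalSpace, contMDiffAt_totalSpace]
  constructor
  · rintro ⟨-, h⟩
    exact ⟨contMDiffAt_snd, h⟩
  · rintro ⟨-, h⟩
    exact ⟨contMDiffAt_id, h⟩

/-- The section `ν ∘ pr₂` of `pr₂^* V` defined by a section `ν` of `V`. -/
def cylPull (s : Cₛ^∞⟮𝓡 n; F, V⟯) : CylSection n F V :=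
  ⟨fun q => s q.2, fun q₀ => (contMDiffAt_cylSection_iff _ q₀).2
    (s.contMDiff.comp contMDiff_snd).contMDiffAt⟩

/-- The restriction `σ(t, ·)` of a section of `pr₂^* V` to `{t} × M`. -/
def cylRestrict (t : ℝ) (σ : CylSection n F V) : Cₛ^∞⟮𝓡 n; F, V⟯ :=
  ⟨fun x => σ (t, x), by
    have h : ContMDiff (cylModel n) ((𝓡 n).prod 𝓘(ℝ, F)) ∞
      (fun q : ℝ × M => (⟨q.2, σ q⟩ : TotalSpace F V)) :=
      fun q₀ => (contMDiffAt_cylSection_iff _ q₀).1 σ.contMDiff.contMDiffAt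
    exact h.comp (contMDiff_const.prodMk contMDiff_id)⟩

@[simp] theorem cylPull_apply (s : Cₛ^∞⟮𝓡 n; F, V⟯) (q : ℝ × M) : cylPull s q = s q.2 := rfl

@[simp] theorem cylRestrict_apply (t : ℝ) (σ : CylSection n F V) (x : M) :
    cylRestrict t σ x = σ (t, x) := rfl

theorem CylSection.contMDiff_total (σ : CylSection n F V) :
    ContMDiff (cylModel n) ((𝓡 n).prod 𝓘(ℝ, F)) ∞
      (fun q : ℝ × M => (⟨q.2, σ q⟩ : TotalSpace F V)) :=
  fun q₀ => (contMDiffAt_cylSection_iff _ q₀).1 σ.contMDiff.contMDiffAt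

variable [IsManifold (𝓡 n) ∞ M]

/-- The derivative at time `t` of the curve `s ↦ σ(s, x)` in the fibre `V x`, computed in a local
trivialization. -/
def cylTimeDerivAt (σ : ∀ q : ℝ × M, V q.2) (q : ℝ × M) : V q.2 :=
  ((trivializationAt F V q.2).continuousLinearEquivAt ℝ q.2
      (FiberBundle.mem_baseSet_trivializationAt' q.2)).symm
    (deriv (fun s => (trivializationAt F V q.2).continuousLinearEquivAt ℝ q.2
      (FiberBundle.mem_baseSet_trivializationAt' q.2) (σ (s, q.2))) q.1)

variable [FiniteDimensional ℝ F]

/-- `cylTimeDerivAt` is the derivative of the curve `s ↦ σ(s, x)`, tested against linear forms. -/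
theorem hasDerivAt_cylTimeDerivAt (σ : CylSection n F V) (q : ℝ × M) (ℓ : V q.2 →ₗ[ℝ] ℝ) :
    HasDerivAt (fun s => ℓ (σ (s, q.2)))
      (ℓ (cylTimeDerivAt (F := F) (V := V) (fun q => σ q) q)) q.1 := by
  let e := (trivializationAt F V q.2).continuousLinearEquivAt ℝ q.2
      (FiberBundle.mem_baseSet_trivializationAt' q.2)
  let w : ℝ → F := fun s => e (σ (s, q.2))
  have hw : ContDiff ℝ ∞ w := by
    have h1 : ContMDiff 𝓘(ℝ, ℝ) ((𝓡 n).prod 𝓘(ℝ, F)) ∞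
        (fun s : ℝ => (⟨q.2, σ (s, q.2)⟩ : TotalSpace F V)) :=
      σ.contMDiff_total.comp (contMDiff_id.prodMk contMDiff_const)
    rw [← contMDiff_iff_contDiff]
    intro s
    have h2 := (contMDiffAt_totalSpace.1 (h1 s)).2
    refine h2.congr_of_eventuallyEq (Filter.Eventually.of_forall fun s' => ?_)
    simp [w, e]
  have hd : HasDerivAt w (deriv w q.1) q.1 := (hw.differentiable (by simp)).differentiableAt.hasDerivAt
  let L : F →L[ℝ] ℝ := LinearMap.toContinuousLinearMap (ℓ ∘ₗ e.symm.toLinearEquiv.toLinearMap)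
  have h3 := L.hasFDerivAt.comp_hasDerivAt q.1 hd
  have h4 : (fun s => ℓ (σ (s, q.2))) = L ∘ w := by
    funext s
    change _ = ℓ (e.symm (e (σ (s, q.2))))
    exact congrArg ℓ (e.symm_apply_apply _).symm
  rw [h4]
  exact h3

theorem cylTimeDerivAt_ext {σ : CylSection n F V} {q : ℝ × M} {v : V q.2}
    (h : ∀ ℓ : V q.2 →ₗ[ℝ] ℝ, HasDerivAt (fun s => ℓ (σ (s, q.2))) (ℓ v) q.1) :
    cylTimeDerivAt (F := F) (V := V) (fun q => σ q) q = v := by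
  refine sub_eq_zero.1 ((Module.forall_dual_apply_eq_zero_iff ℝ (_ : V q.2)).1 fun ℓ => ?_)
  rw [map_sub, sub_eq_zero]
  exact (hasDerivAt_cylTimeDerivAt σ q ℓ).unique (h ℓ)

theorem cylField_derivation_time (f : C^∞⟮cylModel n, ℝ × M; 𝓘(ℝ, ℝ), ℝ⟯) (q : ℝ × M) :
    vectorFieldDerivation (cylField (1, 0)) f q = deriv (fun s => f (s, q.2)) q.1 := by
  obtain ⟨t, x⟩ := q
  have h0 : vectorFieldDerivation 0 (cylSlice t f) x = 0 :=
    (mfderiv (𝓡 n) 𝓘(ℝ, ℝ) (cylSlice t f) x).map_zero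
  rw [cylField_derivation_apply, h0, add_zero, one_mul]

variable [T2Space M] [ContMDiffVectorBundle ∞ F V (𝓡 n)]

/-- The operator `∂/∂t` on sections of `pr₂^* V`. -/
def cylTimeDeriv : Module.End ℝ (CylSection n F V) where
  toFun σ := ⟨fun q => cylTimeDerivAt (F := F) (V := V) (fun q => σ q) q, by
    intro q₀
    obtain ⟨r, χ, s, c, hχ, hc, h⟩ := exists_cutoff_frame (F := F) (V := V) (𝓡 n) q₀.2
    let g : Fin r → C^∞⟮cylModel n, ℝ × M; 𝓘(ℝ, ℝ), ℝ⟯ := fun i =>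
      smoothFun (fun q => c i q.2 (σ q)) ((hc i).comp σ.contMDiff_total)
    let τ : CylSection n F V := ∑ i, vectorFieldDerivation (cylField (1, 0)) (g i) • cylPull (s i)
    refine (τ.contMDiff q₀).congr_of_eventuallyEq ?_
    have h1 : ∀ᶠ q : ℝ × M in 𝓝 q₀, χ q.2 = 1 := continuous_snd.continuousAt.eventually hχ
    refine h1.mono fun q hq => ?_
    refine congrArg (TotalSpace.mk q) ?_
    have h2 := h q.2 (cylTimeDerivAt (F := F) (V := V) (fun q => σ q) q)
    rw [hq, one_smul] at h2
    refine h2.trans ?_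
    rw [ContMDiffSection.sum_apply']
    refine Finset.sum_congr rfl fun i _ => ?_
    refine congrArg (fun z : ℝ => z • s i q.2) ?_
    rw [cylField_derivation_time]
    exact (hasDerivAt_cylTimeDerivAt σ q (c i q.2)).deriv.symm⟩
  map_add' σ τ := ContMDiffSection.ext fun q => cylTimeDerivAt_ext fun ℓ => by
    have := (hasDerivAt_cylTimeDerivAt σ q ℓ).add (hasDerivAt_cylTimeDerivAt τ q ℓ)
    refine (this.congr_deriv (map_add ℓ _ _).symm).congr_of_eventuallyEq
      (Filter.Eventually.of_forall fun s => map_add ℓ _ _)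
  map_smul' a σ := ContMDiffSection.ext fun q => cylTimeDerivAt_ext fun ℓ => by
    have := (hasDerivAt_cylTimeDerivAt σ q ℓ).const_smul a
    refine (this.congr_deriv (map_smul ℓ _ _).symm).congr_of_eventuallyEq
      (Filter.Eventually.of_forall fun s => map_smul ℓ _ _)

theorem cylTimeDeriv_apply (σ : CylSection n F V) (q : ℝ × M) :
    cylTimeDeriv σ q = cylTimeDerivAt (F := F) (V := V) (fun q => σ q) q := rfl

theorem cylTimeDeriv_smul (f : C^∞⟮cylModel n, ℝ × M; 𝓘(ℝ, ℝ), ℝ⟯) (σ : CylSection n F V) :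
    cylTimeDeriv (f • σ) = f • cylTimeDeriv σ + vectorFieldDerivation (cylField (1, 0)) f • σ :=
  ContMDiffSection.ext fun q => cylTimeDerivAt_ext fun ℓ => by
    have h1 : HasDerivAt (fun s => f (s, q.2)) (vectorFieldDerivation (cylField (1, 0)) f q) q.1 := by
      rw [cylField_derivation_time]
      have h2 : ContMDiff 𝓘(ℝ, ℝ) 𝓘(ℝ, ℝ) ∞ (fun s : ℝ => f (s, q.2)) :=
        f.contMDiff.comp (contMDiff_id.prodMk contMDiff_const)
      exact (h2.contDiff.differentiable (by simp)).differentiableAt.hasDerivAt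
    have h3 := h1.mul (hasDerivAt_cylTimeDerivAt σ q ℓ)
    refine (h3.congr_deriv ?_).congr_of_eventuallyEq
      (Filter.Eventually.of_forall fun s => map_smul ℓ _ _)
    refine Eq.trans ?_ (map_add ℓ _ _).symm
    have e1 : ℓ ((f • cylTimeDeriv σ) q) = f q * ℓ (cylTimeDeriv σ q) := map_smul ℓ _ _
    have e2 : ℓ ((vectorFieldDerivation (cylField (1, 0)) f • σ) q) =
      vectorFieldDerivation (cylField (1, 0)) f q * ℓ (σ q) := map_smul ℓ _ _
    rw [e1, e2, add_comm]
    rfl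

/-- The lift to `pr₂^* V` of an operator `D` on sections of `V`, acting slicewise:
`(D̃ σ)(t, ·) = D(σ(t, ·))`. Here `D` is a covariant differential operator with symbol `X`. -/
def cylLift (X : Cₛ^∞⟮𝓡 n; EuclideanSpace ℝ (Fin n), (TangentSpace (𝓡 n) : M → Type _)⟯)
    (D : Module.End ℝ Cₛ^∞⟮𝓡 n; F, V⟯)
    (hD : ∀ (f : C^∞⟮𝓡 n, M; 𝓘(ℝ, ℝ), ℝ⟯) (s : Cₛ^∞⟮𝓡 n; F, V⟯),
      D (f • s) = f • D s + vectorFieldDerivation X f • s) :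
    Module.End ℝ (CylSection n F V) where
  toFun σ := ⟨fun q => D (cylRestrict q.1 σ) q.2, by
    intro q₀
    obtain ⟨r, χ, s, c, hχ, hc, h⟩ := exists_cutoff_frame (F := F) (V := V) (𝓡 n) q₀.2
    let g : Fin r → C^∞⟮cylModel n, ℝ × M; 𝓘(ℝ, ℝ), ℝ⟯ := fun i =>
      smoothFun (fun q => c i q.2 (σ q)) ((hc i).comp σ.contMDiff_total)
    let dχ : C^∞⟮cylModel n, ℝ × M; 𝓘(ℝ, ℝ), ℝ⟯ := (vectorFieldDerivation X χ).comp (cylProj n M)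
    let τ : CylSection n F V := ∑ i, (g i • cylPull (D (s i)) +
      vectorFieldDerivation (cylField (0, X)) (g i) • cylPull (s i)) - dχ • σ
    refine (τ.contMDiff q₀).congr_of_eventuallyEq ?_
    have h1 : ∀ᶠ q : ℝ × M in 𝓝 q₀, χ q.2 = 1 := continuous_snd.continuousAt.eventually hχ
    refine h1.mono fun q hq => ?_
    refine congrArg (TotalSpace.mk q) ?_
    have h2 := congrArg (fun τ => D τ q.2) (cutoff_frame_sections hc h (cylRestrict q.1 σ))
    simp only [hD, map_sum] at h2
    rw [ContMDiffSection.sum_apply'] at h2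
    have h3 : (D (cylRestrict q.1 σ) q.2 : V q.2) = (∑ i, (c i q.2 (σ q) • D (s i) q.2 +
        vectorFieldDerivation X (cylSlice q.1 (g i)) q.2 • s i q.2) : V q.2) -
        vectorFieldDerivation X χ q.2 • cylRestrict q.1 σ q.2 := by
      rw [eq_sub_iff_add_eq]
      refine Eq.trans ?_ h2
      change _ = χ q.2 • D (cylRestrict q.1 σ) q.2 + _
      rw [hq, one_smul]
      rfl
    refine h3.trans ?_
    change _ = (∑ i, (g i • cylPull (D (s i)) +
      vectorFieldDerivation (cylField (0, X)) (g i) • cylPull (s i)) : CylSection n F V) q - _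
    rw [ContMDiffSection.sum_apply']
    refine congrArg₂ (fun a b : V q.2 => a - b) ?_ rfl
    refine Finset.sum_congr rfl fun i _ => ?_
    refine congrArg (fun z : ℝ => c i q.2 (σ q) • D (s i) q.2 + z • s i q.2) ?_
    obtain ⟨t, x⟩ := q
    rw [cylField_derivation_apply, zero_mul, zero_add]⟩
  map_add' σ τ := ContMDiffSection.ext fun q =>
    congrArg (fun s : Cₛ^∞⟮𝓡 n; F, V⟯ => s q.2) (D.map_add (cylRestrict q.1 σ) (cylRestrict q.1 τ))
  map_smul' a σ := ContMDiffSection.ext fun q =>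
    congrArg (fun s : Cₛ^∞⟮𝓡 n; F, V⟯ => s q.2) (D.map_smul a (cylRestrict q.1 σ))

end CylinderSections

section FibreIntegral

/-- Differentiation under the integral sign, for smooth integrands. -/
theorem contDiffOn_integral_unit {P : Type*} [NormedAddCommGroup P] [NormedSpace ℝ P] {s : Set P}
    (hs : IsOpen s) {G : ℝ × P → ℝ} (hG : ContDiffOn ℝ ∞ G (Set.univ ×ˢ s)) :
    ContDiffOn ℝ ∞ (fun p => ∫ t in (0 : ℝ)..1, G (t, p)) s := by
  let ψ : ContDiffBump (0 : ℝ) := ⟨2, 3, by norm_num, by norm_num⟩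
  let g : P → ℝ → ℝ := fun p r => ψ r * G (-r, p)
  let f : ℝ → ℝ := Set.indicator (Set.Ioc 0 1) 1
  have hf : MeasureTheory.LocallyIntegrable f MeasureTheory.volume := by
    refine MeasureTheory.Integrable.locallyIntegrable ?_
    exact (MeasureTheory.integrable_indicator_iff measurableSet_Ioc).2
      (MeasureTheory.integrableOn_const (by simp))
  have hg : ContDiffOn ℝ ∞ (Function.uncurry g) (s ×ˢ Set.univ) := by
    refine ContDiffOn.mul (ψ.contDiff.comp contDiff_snd).contDiffOn ?_
    refine hG.comp (t := Set.univ ×ˢ s) (f := fun q : P × ℝ => (-q.2, q.1))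
      (contDiff_snd.neg.prodMk contDiff_fst).contDiffOn ?_
    intro q hq
    exact ⟨trivial, hq.1⟩
  have key := MeasureTheory.contDiffOn_convolution_right_with_param_comp (μ := MeasureTheory.volume) (n := ⊤)
    (ContinuousLinearMap.mul ℝ ℝ)
    (v := fun _ : P => (0 : ℝ)) contDiffOn_const (f := f) (g := g) (k := Metric.closedBall 0 3) hs
    (isCompact_closedBall _ _) (fun p x _ hx => by
      have h0 : ψ x = 0 := ψ.zero_of_le_dist (by
        rw [Metric.mem_closedBall, not_le] at hx
        exact hx.le)
      simp [g, h0]) hf hg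
  refine key.congr fun p _ => ?_
  change _ = ∫ t, f t * g p (0 - t)
  rw [intervalIntegral.integral_of_le zero_le_one,
    ← MeasureTheory.integral_indicator measurableSet_Ioc]
  refine MeasureTheory.integral_congr_ae (Filter.Eventually.of_forall fun t => ?_)
  by_cases ht : t ∈ Set.Ioc (0 : ℝ) 1
  · have h1 : ψ (-t) = 1 := ψ.one_of_mem_closedBall (by
      rw [Metric.mem_closedBall, dist_zero_right, norm_neg, Real.norm_eq_abs, abs_of_pos ht.1]
      exact ht.2.trans (by norm_num [ψ]))
    simp [f, g, ht, h1]
  · simp [f, ht]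

variable {n : ℕ} {M : Type*} [TopologicalSpace M]
  [ChartedSpace (EuclideanSpace ℝ (Fin n)) M] [IsManifold (𝓡 n) ∞ M]

theorem cylSlice_intervalIntegrable (f : C^∞⟮cylModel n, ℝ × M; 𝓘(ℝ, ℝ), ℝ⟯) (x : M) :
    IntervalIntegrable (fun t => f (t, x)) MeasureTheory.volume 0 1 :=
  (f.contMDiff.continuous.comp (Continuous.prodMk_left x)).intervalIntegrable 0 1

/-- The map `C^∞(ℝ × M) → C^∞(M)`, `f ↦ (x ↦ ∫_0^1 f(t, x) dt)`. -/
def cylIntegral : C^∞⟮cylModel n, ℝ × M; 𝓘(ℝ, ℝ), ℝ⟯ →ₗ[ℝ] C^∞⟮𝓡 n, M; 𝓘(ℝ, ℝ), ℝ⟯ where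
  toFun f := ⟨fun x => ∫ t in (0 : ℝ)..1, f (t, x), by
    intro x
    let φ := extChartAt (𝓡 n) x
    have h1 : ContMDiffOn 𝓘(ℝ, EuclideanSpace ℝ (Fin n)) (𝓡 n) ∞ φ.symm φ.target :=
      contMDiffOn_extChartAt_symm x
    have ho : IsOpen φ.target := isOpen_extChartAt_target x
    let G : ℝ × EuclideanSpace ℝ (Fin n) → ℝ := fun q => f (q.1, φ.symm q.2)
    have hG : ContDiffOn ℝ ∞ G (Set.univ ×ˢ φ.target) := by
      rintro ⟨s, y⟩ ⟨-, hy⟩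
      have h2 : ContMDiffAt 𝓘(ℝ, EuclideanSpace ℝ (Fin n)) (𝓡 n) ∞ φ.symm y :=
        h1.contMDiffAt (ho.mem_nhds hy)
      have h3 : ContMDiffAt (𝓘(ℝ, ℝ).prod 𝓘(ℝ, EuclideanSpace ℝ (Fin n))) (cylModel n) ∞
          (fun q : ℝ × EuclideanSpace ℝ (Fin n) => (q.1, φ.symm q.2)) (s, y) :=
        contMDiffAt_fst.prodMk (ContMDiffAt.comp (s, y) h2 contMDiffAt_snd)
      have h4 : ContMDiffAt (𝓘(ℝ, ℝ).prod 𝓘(ℝ, EuclideanSpace ℝ (Fin n))) 𝓘(ℝ, ℝ) ∞ G (s, y) :=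
        f.contMDiff.contMDiffAt.comp (s, y) h3
      rw [← modelWithCornersSelf_prod, chartedSpaceSelf_prod] at h4
      exact h4.contDiffAt.contDiffWithinAt
    have h5 := (contDiffOn_integral_unit ho hG).contDiffAt (ho.mem_nhds (mem_extChartAt_target x))
    have h6 : ContMDiffAt (𝓡 n) 𝓘(ℝ, EuclideanSpace ℝ (Fin n)) ∞ φ x := contMDiffAt_extChartAt
    have h7 := h5.contMDiffAt.comp x h6
    refine h7.congr_of_eventuallyEq ?_
    filter_upwards [extChartAt_source_mem_nhds (I := 𝓡 n) x] with y hy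
    have h8 : φ.symm (φ y) = y := φ.left_inv hy
    change _ = ∫ t in (0 : ℝ)..1, f (t, φ.symm (φ y))
    rw [h8]⟩
  map_add' f g := ContMDiffMap.ext fun x => intervalIntegral.integral_add
    (cylSlice_intervalIntegrable f x) (cylSlice_intervalIntegrable g x)
  map_smul' c f := ContMDiffMap.ext fun x => intervalIntegral.integral_smul c _

@[simp] theorem cylIntegral_apply (f : C^∞⟮cylModel n, ℝ × M; 𝓘(ℝ, ℝ), ℝ⟯) (x : M) :
    cylIntegral f x = ∫ t in (0 : ℝ)..1, f (t, x) := rfl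

end FibreIntegral

section ChernForms

/-- The Chern character form `ch_p = Tr((R^∇)^p)` of an `ℝ`-linear connection on the sections of
a vector bundle `V → N`. -/
def RLinearConnection.chernForm {L : Type*} [LieRing L] [LieAlgebra ℝ L]
    {E : Type*} [NormedAddCommGroup E] [NormedSpace ℝ E] [FiniteDimensional ℝ E]
    {H : Type*} [TopologicalSpace H] {I : ModelWithCorners ℝ E H}
    {N : Type*} [TopologicalSpace N] [ChartedSpace H N] [IsManifold I ∞ N] [T2Space N]
    {F : Type*} [NormedAddCommGroup F] [NormedSpace ℝ F] [FiniteDimensional ℝ F]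
    {V : N → Type*} [TopologicalSpace (TotalSpace F V)] [∀ x, AddCommGroup (V x)]
    [∀ x, Module ℝ (V x)] [∀ x, TopologicalSpace (V x)] [FiberBundle F V] [VectorBundle ℝ F V]
    [ContMDiffVectorBundle ∞ F V I]
    {δ : L →ₗ⁅ℝ⁆ Derivation ℝ C^∞⟮I, N; 𝓘(ℝ, ℝ), ℝ⟯ C^∞⟮I, N; 𝓘(ℝ, ℝ), ℝ⟯}
    (D : RLinearConnection δ Cₛ^∞⟮I; F, V⟯) (p : ℕ) :
    AltForm L C^∞⟮I, N; 𝓘(ℝ, ℝ), ℝ⟯ (2 * p) :=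
  (smoothTrace.restrictScalars ℝ).compAlternatingMap (alternatingPower D.curvature p)

variable {n : ℕ} {M : Type*} [TopologicalSpace M]
  [ChartedSpace (EuclideanSpace ℝ (Fin n)) M] [IsManifold (𝓡 n) ∞ M] [T2Space M]
  {FA : Type*} [NormedAddCommGroup FA] [NormedSpace ℝ FA] [FiniteDimensional ℝ FA]
  {A : M → Type*} [TopologicalSpace (TotalSpace FA A)] [∀ x, AddCommGroup (A x)]
  [∀ x, Module ℝ (A x)] [∀ x, TopologicalSpace (A x)] [FiberBundle FA A]
  [VectorBundle ℝ FA A] [ContMDiffVectorBundle ∞ FA A (𝓡 n)]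
  {F : Type*} [NormedAddCommGroup F] [NormedSpace ℝ F] [FiniteDimensional ℝ F]
  {V : M → Type*} [TopologicalSpace (TotalSpace F V)] [∀ x, AddCommGroup (V x)]
  [∀ x, Module ℝ (V x)] [∀ x, TopologicalSpace (V x)] [FiberBundle F V] [VectorBundle ℝ F V]
  [ContMDiffVectorBundle ∞ F V (𝓡 n)]

/-- The one-dimensional abelian Lie algebra `ℝ`. -/
instance realLieRing : LieRing ℝ where
  bracket _ _ := 0
  add_lie _ _ _ := (add_zero 0).symm
  lie_add _ _ _ := (add_zero 0).symm
  lie_self _ := rfl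
  leibniz_lie _ _ _ := (add_zero 0).symm

instance realLieAlgebra : LieAlgebra ℝ ℝ where
  lie_smul c _ _ := (smul_zero c).symm

namespace LieAlgebroid

/-- The Lie algebra `ℝ ∂/∂t ⊕ Γ(A)` of sections of `Tℝ × A → ℝ × M` (with its componentwise
bracket) acts on `C^∞(ℝ × M)` by `(r, a) ↦ r ∂/∂t + ρ_A ∘ a`. -/
def cylDerivation (𝒜 : LieAlgebroid n FA A) : (ℝ × 𝒜.Sec) →ₗ⁅ℝ⁆
    Derivation ℝ C^∞⟮cylModel n, ℝ × M; 𝓘(ℝ, ℝ), ℝ⟯ C^∞⟮cylModel n, ℝ × M; 𝓘(ℝ, ℝ), ℝ⟯ where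
  toFun u := vectorFieldDerivation (cylField (u.1, 𝒜.anchorField u.2))
  map_add' u v := by
    rw [← vectorFieldDerivation_add, ← map_add, Prod.fst_add, Prod.snd_add, 𝒜.anchorField.map_add]
    rfl
  map_smul' c u := by
    rw [RingHom.id_apply, ← vectorFieldDerivation_smul, ← map_smul, Prod.smul_fst, Prod.smul_snd,
      𝒜.anchorField.map_smul]
    rfl
  map_lie' {u v} := by
    let T : C^∞⟮cylModel n, ℝ × M; 𝓘(ℝ, ℝ), ℝ⟯ → C^∞⟮cylModel n, ℝ × M; 𝓘(ℝ, ℝ), ℝ⟯ :=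
      fun f => vectorFieldDerivation (cylField (1, 0)) f
    let X : 𝒜.Sec → C^∞⟮cylModel n, ℝ × M; 𝓘(ℝ, ℝ), ℝ⟯ → C^∞⟮cylModel n, ℝ × M; 𝓘(ℝ, ℝ), ℝ⟯ :=
      fun a f => vectorFieldDerivation (cylField (0, 𝒜.anchorField a)) f
    have hX : ∀ a f t x, X a f (t, x) = 𝒜.anchorDerivation a (cylSlice t f) x := by
      intro a f t x
      change vectorFieldDerivation (cylField (0, 𝒜.anchorField a)) f (t, x) = _
      rw [cylField_derivation_apply, zero_mul, zero_add]
      rfl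
    have hsl : ∀ a f t, cylSlice t (X a f) = 𝒜.anchorDerivation a (cylSlice t f) := by
      intro a f t
      ext x
      exact hX a f t x
    have hTX : ∀ a f, T (X a f) = X a (T f) := fun a f => cyl_mixed_partials _ f
    have hdec : ∀ (u : ℝ × 𝒜.Sec) f,
        vectorFieldDerivation (cylField (u.1, 𝒜.anchorField u.2)) f = u.1 • T f + X u.2 f := by
      intro u f
      have h1 : (u.1, 𝒜.anchorField u.2) = u.1 • (1, 0) + (0, 𝒜.anchorField u.2) := by
        ext <;> simp
      rw [h1, map_add, map_smul, vectorFieldDerivation_add, vectorFieldDerivation_smul]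
      rfl
    have hlie : ∀ a b f, X ⁅a, b⁆ f = X a (X b f) - X b (X a f) := by
      intro a b f
      ext ⟨t, x⟩
      change X ⁅a, b⁆ f (t, x) = X a (X b f) (t, x) - X b (X a f) (t, x)
      rw [hX, hX, hX, hsl, hsl, LieHom.map_lie]
      rfl
    have hT : ∀ f g (r : ℝ), T (r • f + g) = r • T f + T g := fun f g r => by
      simp only [T, map_add, Derivation.map_smul]
    have hX' : ∀ a f g (r : ℝ), X a (r • f + g) = r • X a f + X a g := fun a f g r => by
      simp only [X, map_add, Derivation.map_smul]
    refine Derivation.ext fun f => ?_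
    change vectorFieldDerivation (cylField (⁅u, v⁆.1, 𝒜.anchorField ⁅u, v⁆.2)) f =
      vectorFieldDerivation (cylField (u.1, 𝒜.anchorField u.2))
        (vectorFieldDerivation (cylField (v.1, 𝒜.anchorField v.2)) f) -
      vectorFieldDerivation (cylField (v.1, 𝒜.anchorField v.2))
        (vectorFieldDerivation (cylField (u.1, 𝒜.anchorField u.2)) f)
    rw [hdec, hdec, hdec, hdec, hdec, hT, hT, hX', hX', hTX, hTX]
    have h0 : ⁅u, v⁆.1 = (0 : ℝ) := rfl
    have h1 : ⁅u, v⁆.2 = ⁅u.2, v.2⁆ := rfl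
    rw [h0, h1, hlie, zero_smul, zero_add, smul_add, smul_add, smul_smul, smul_smul,
      mul_comm v.1 u.1]
    abel

theorem cylDerivation_apply (𝒜 : LieAlgebroid n FA A) (u : ℝ × 𝒜.Sec)
    (f : C^∞⟮cylModel n, ℝ × M; 𝓘(ℝ, ℝ), ℝ⟯) (t : ℝ) (x : M) :
    𝒜.cylDerivation u f (t, x) =
      u.1 * deriv (fun s => f (s, x)) t + 𝒜.anchorDerivation u.2 (cylSlice t f) x :=
  cylField_derivation_apply _ _ f t x

/-- `ℝ`-linear `A`-connections `∇ : Γ(A) → CDO(V)` on a vector bundle `V`: `∇_a` is a covariant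
differential operator with symbol `ρ_A ∘ a`, and `∇` is `ℝ`-linear in `a`. -/
abbrev Connection (𝒜 : LieAlgebroid n FA A) (F : Type*) [NormedAddCommGroup F] [NormedSpace ℝ F]
    (V : M → Type*) [TopologicalSpace (TotalSpace F V)] [∀ x, AddCommGroup (V x)]
    [∀ x, Module ℝ (V x)] [∀ x, TopologicalSpace (V x)] [FiberBundle F V] [VectorBundle ℝ F V] :
    Type _ := RLinearConnection 𝒜.anchorDerivation Cₛ^∞⟮𝓡 n; F, V⟯

variable {𝒜 : LieAlgebroid n FA A}

/-- The operator `∇̃_a` on sections of `pr₂^* V` defined by `(∇̃_a σ)(t, ·) = ∇_a(σ(t, ·))`. -/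
def Connection.lift (D : 𝒜.Connection F V) : 𝒜.Sec →ₗ[ℝ] Module.End ℝ (CylSection n F V) where
  toFun a := cylLift (𝒜.anchorField a) (D a) (D.leibniz a)
  map_add' a b := LinearMap.ext fun σ => ContMDiffSection.ext fun q =>
    congrArg (fun T : Module.End ℝ Cₛ^∞⟮𝓡 n; F, V⟯ => T (cylRestrict q.1 σ) q.2)
      (D.toLinearMap.map_add a b)
  map_smul' c a := LinearMap.ext fun σ => ContMDiffSection.ext fun q =>
    congrArg (fun T : Module.End ℝ Cₛ^∞⟮𝓡 n; F, V⟯ => T (cylRestrict q.1 σ) q.2)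
      (D.toLinearMap.map_smul c a)

theorem Connection.lift_apply (D : 𝒜.Connection F V) (a : 𝒜.Sec) (σ : CylSection n F V)
    (q : ℝ × M) : D.lift a σ q = D a (cylRestrict q.1 σ) q.2 := rfl

theorem Connection.lift_smul (D : 𝒜.Connection F V) (a : 𝒜.Sec)
    (f : C^∞⟮cylModel n, ℝ × M; 𝓘(ℝ, ℝ), ℝ⟯) (σ : CylSection n F V) :
    D.lift a (f • σ) = f • D.lift a σ + 𝒜.cylDerivation (0, a) f • σ :=
  ContMDiffSection.ext fun q => by
    obtain ⟨t, x⟩ := q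
    have h := congrArg (fun s : Cₛ^∞⟮𝓡 n; F, V⟯ => s x)
      (D.leibniz a (cylSlice t f) (cylRestrict t σ))
    refine Eq.trans h ?_
    refine congrArg (fun z : ℝ => f (t, x) • D a (cylRestrict t σ) x + z • cylRestrict t σ x) ?_
    rw [cylDerivation_apply, zero_mul, zero_add]

/-- The affine combination `∇^aff = (1 - t) ∇⁰ + t ∇¹` of two `ℝ`-linear `A`-connections on `V`,
a connection on `pr₂^* V` along `ℝ ∂/∂t ⊕ Γ(A)`:
`∇^aff_{∂/∂t} = ∂/∂t` and `∇^aff_a = (1 - t) ∇̃⁰_a + t ∇̃¹_a`. -/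
def affineConnection (D₀ D₁ : 𝒜.Connection F V) :
    RLinearConnection 𝒜.cylDerivation (CylSection n F V) where
  toLinearMap := (LinearMap.fst ℝ ℝ 𝒜.Sec).smulRight cylTimeDeriv +
    ((1 - cylTime (n := n) (M := M)) • D₀.lift + cylTime (n := n) (M := M) • D₁.lift) ∘ₗ
      LinearMap.snd ℝ ℝ 𝒜.Sec
  leibniz u f σ := by
    have h : 𝒜.cylDerivation u f =
        u.1 • vectorFieldDerivation (cylField (1, 0)) f + 𝒜.cylDerivation (0, u.2) f := by
      ext ⟨t, x⟩
      change _ = u.1 * vectorFieldDerivation (cylField (1, 0)) f (t, x) +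
        𝒜.cylDerivation (0, u.2) f (t, x)
      rw [cylDerivation_apply, cylDerivation_apply, cylField_derivation_time, zero_mul, zero_add]
    change u.1 • cylTimeDeriv (f • σ) + ((1 - cylTime (n := n) (M := M)) • D₀.lift u.2 (f • σ) +
        cylTime (n := n) (M := M) • D₁.lift u.2 (f • σ)) =
      f • (u.1 • cylTimeDeriv σ + ((1 - cylTime (n := n) (M := M)) • D₀.lift u.2 σ +
        cylTime (n := n) (M := M) • D₁.lift u.2 σ)) + _
    rw [h, cylTimeDeriv_smul, Connection.lift_smul, Connection.lift_smul]
    generalize cylTimeDeriv σ = w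
    generalize D₀.lift u.2 σ = w₀
    generalize D₁.lift u.2 σ = w₁
    generalize 𝒜.cylDerivation (0, u.2) f = b
    generalize vectorFieldDerivation (cylField (1, 0)) f = b'
    refine ContMDiffSection.ext fun q => ?_
    change u.1 • (f q • w q + b' q • σ q) + ((1 - q.1) • (f q • w₀ q + b q • σ q) +
      q.1 • (f q • w₁ q + b q • σ q)) = f q • (u.1 • w q + ((1 - q.1) • w₀ q + q.1 • w₁ q)) +
      (u.1 * b' q + b q) • σ q
    module

theorem affineConnection_apply (D₀ D₁ : 𝒜.Connection F V) (u : ℝ × 𝒜.Sec) (σ : CylSection n F V) :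
    affineConnection D₀ D₁ u σ = u.1 • cylTimeDeriv σ +
      ((1 - cylTime (n := n) (M := M)) • D₀.lift u.2 σ +
        cylTime (n := n) (M := M) • D₁.lift u.2 σ) := rfl

/-- The Chern–Simons form `cs_{p+1}(∇⁰, ∇¹)`, the integral over the unit interval of the Chern
character form of `∇^aff`:
`cs_{p+1}(a_1, …, a_{2p+1}) = ∫_0^1 ch_{p+1}(∇^aff)(∂/∂t, a_1, …, a_{2p+1}) dt`. -/
def chernSimons (D₀ D₁ : 𝒜.Connection F V) (p : ℕ) : 𝒜.Form (2 * p + 1) :=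
  cylIntegral.compAlternatingMap
    ((AlternatingMap.curryLeft (n := 2 * p + 1)
      ((affineConnection D₀ D₁).chernForm (p + 1)) (1, 0)).compLinearMap
        (LinearMap.inr ℝ ℝ 𝒜.Sec))

end LieAlgebroid
end ChernForms

end

/-
The connection induced on `End E` is a derivation of composition for which the curvature satisfies
the Bianchi identity, so the powers of the curvature are closed; the fibrewise trace intertwines the
induced connection with the action of `ρ_A` on functions, so `ch_p(∇)` is closed as well. Applied to
`∇^aff` on `ℝ × M` this gives a closed form there. Since `∂/∂t` is central, Cartan's formula
identifies the differential of its contraction with `∂/∂t` with the time derivative of its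
restriction to the slices, which are the forms `ch_p((1 - t)∇⁰ + t∇¹)`; integrating over `[0, 1]`
yields the transgression formula. Only finitely many classes are nonzero: a partition of unity
provides a connection that is `C^∞(M)`-linear in the section of `A`, its Chern forms are tensorial,
hence they vanish above the rank of `A`.
-/

noncomputable section

set_option maxSynthPendingDepth 3

theorem existsUnique_directSum_of_injective {ι κ : Type*} {β : κ → Type*}
    [∀ k, AddCommMonoid (β k)] {e : ι → κ} (he : Function.Injective e) (b : ∀ i, β (e i))
    (hb : {i | b i ≠ 0}.Finite) :
    ∃! c : DirectSum κ β, (∀ i, c (e i) = b i) ∧ ∀ k, (¬ ∃ i, k = e i) → c k = 0 := by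
  classical
  let c : DirectSum κ β := ∑ i ∈ hb.toFinset, DirectSum.of β (e i) (b i)
  have hc : ∀ k, c k = ∑ i ∈ hb.toFinset, DirectSum.of β (e i) (b i) k := fun k =>
    DFinsupp.finsetSum_apply _ _ k
  have hc_apply : ∀ i, c (e i) = b i := fun i => by
    rw [hc, Finset.sum_eq_single i
      (fun j _ hj => DirectSum.of_eq_of_ne _ _ _ (he.ne hj.symm)) fun hi => ?_,
      DirectSum.of_eq_same]
    rw [DirectSum.of_eq_same]
    exact not_not.1 fun h => hi (hb.mem_toFinset.2 h)
  have hc_zero : ∀ k, (¬ ∃ i, k = e i) → c k = 0 := fun k hk => by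
    rw [hc]
    exact Finset.sum_eq_zero fun i _ => DirectSum.of_eq_of_ne _ _ _ fun h => hk ⟨i, h⟩
  refine ⟨c, ⟨hc_apply, hc_zero⟩, fun c' ⟨hc'_apply, hc'_zero⟩ => DFinsupp.ext fun k => ?_⟩
  by_cases hk : ∃ i, k = e i
  · obtain ⟨i, rfl⟩ := hk
    exact (hc'_apply i).trans (hc_apply i).symm
  · exact (hc'_zero k hk).trans (hc_zero k hk).symm

section Alternation

open AlternatingMap (alternatizeUncurryFin alternatizeUncurryFinLM)

variable {R : Type*} [CommRing R] {L : Type*} [AddCommGroup L] [Module R L]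
  {W : Type*} [AddCommGroup W] [Module R W] {n : ℕ}

/-- Alternation of a map that is bilinear in two arguments and alternating in the others. -/
def alternate₂ : (L →ₗ[R] L →ₗ[R] L [⋀^Fin n]→ₗ[R] W) →ₗ[R] L [⋀^Fin (n + 2)]→ₗ[R] W :=
  alternatizeUncurryFinLM ∘ₗ LinearMap.compRight R alternatizeUncurryFinLM

/-- Alternation of a map that is trilinear in three arguments and alternating in the others. -/
def alternate₃ : (L →ₗ[R] L →ₗ[R] L →ₗ[R] L [⋀^Fin n]→ₗ[R] W) →ₗ[R] L [⋀^Fin (n + 3)]→ₗ[R] W :=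
  alternatizeUncurryFinLM ∘ₗ LinearMap.compRight R alternate₂

/-- The cyclic permutation `(a, b, c) ↦ f b c a` of the arguments of a trilinear map. -/
def rotate {X : Type*} [AddCommGroup X] [Module R X] (f : L →ₗ[R] L →ₗ[R] L →ₗ[R] X) :
    L →ₗ[R] L →ₗ[R] L →ₗ[R] X :=
  ((LinearMap.lflip (R₀ := R)).toLinearMap ∘ₗ f).flip

theorem alternate₂_eq (f : L →ₗ[R] L →ₗ[R] L [⋀^Fin n]→ₗ[R] W) :
    alternate₂ f = alternatizeUncurryFinLM (alternatizeUncurryFinLM ∘ₗ f) := rfl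

theorem alternate₃_eq (f : L →ₗ[R] L →ₗ[R] L →ₗ[R] L [⋀^Fin n]→ₗ[R] W) :
    alternate₃ f = alternatizeUncurryFinLM (alternate₂ ∘ₗ f) := rfl

theorem alternate₃_eq_alternate₂ (f : L →ₗ[R] L →ₗ[R] L →ₗ[R] L [⋀^Fin n]→ₗ[R] W) :
    alternate₃ f = alternate₂ (LinearMap.compRight R alternatizeUncurryFinLM ∘ₗ f) := rfl

theorem alternate₂_flip (f : L →ₗ[R] L →ₗ[R] L [⋀^Fin n]→ₗ[R] W) :
    alternate₂ f.flip = -alternate₂ f := by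
  have h_sum : alternate₂ (f + f.flip) = 0 :=
    AlternatingMap.alternatizeUncurryFin_alternatizeUncurryFinLM_comp_of_symmetric
      fun a b => add_comm (f a b) (f b a)
  rw [map_add] at h_sum
  exact eq_neg_of_add_eq_zero_right h_sum

/-- A rotation is a product of two transpositions. -/
theorem alternate₃_rotate (f : L →ₗ[R] L →ₗ[R] L →ₗ[R] L [⋀^Fin n]→ₗ[R] W) :
    alternate₃ (rotate f) = alternate₃ f := by
  let f' : L →ₗ[R] L →ₗ[R] L →ₗ[R] L [⋀^Fin n]→ₗ[R] W :=
    (LinearMap.lflip (R₀ := R)).toLinearMap ∘ₗ f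
  have h_outer : alternate₃ (rotate f) = -alternate₃ f' :=
    alternate₂_flip (LinearMap.compRight R alternatizeUncurryFinLM ∘ₗ f')
  have h_inner : alternate₂ ∘ₗ f' = -(alternate₂ ∘ₗ f) :=
    LinearMap.ext fun a => alternate₂_flip (f a)
  rw [h_outer, alternate₃_eq, h_inner, map_neg, neg_neg, ← alternate₃_eq]

theorem alternate₃_eq_zero_of_cyclic_sum [Invertible (3 : R)]
    {f : L →ₗ[R] L →ₗ[R] L →ₗ[R] L [⋀^Fin n]→ₗ[R] W}
    (h : ∀ a b c, f a b c + f b c a + f c a b = 0) : alternate₃ f = 0 := by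
  have h_sum : f + rotate f + rotate (rotate f) = 0 := by
    ext a b c v
    exact DFunLike.congr_fun (h a b c) v
  have h_three : (3 : R) • alternate₃ f = 0 := by
    have := congrArg alternate₃ h_sum
    simp only [map_add, alternate₃_rotate, map_zero] at this
    rw [← this]
    module
  exact (isUnit_of_invertible (3 : R)).smul_eq_zero.1 h_three

/-- Contraction of an alternating map with `c` in its first argument. -/
def interiorProduct (c : L) : (L [⋀^Fin (n + 1)]→ₗ[R] W) →ₗ[R] L [⋀^Fin n]→ₗ[R] W :=
  LinearMap.applyₗ c ∘ₗ AlternatingMap.curryLeftLinearMap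

theorem interiorProduct_apply (c : L) (η : L [⋀^Fin (n + 1)]→ₗ[R] W) (v : Fin n → L) :
    interiorProduct c η v = η (Matrix.vecCons c v) := rfl

theorem interiorProduct_swap (η : L [⋀^Fin (n + 2)]→ₗ[R] W) (a b : L) :
    interiorProduct b (interiorProduct a η) = -interiorProduct a (interiorProduct b η) := by
  have h : (η.curryLeft (a + b)).curryLeft (a + b) = 0 := AlternatingMap.curryLeft_same η _
  simp only [map_add, AlternatingMap.curryLeft_add, LinearMap.add_apply,
    AlternatingMap.curryLeft_same, zero_add, add_zero] at h
  exact eq_neg_of_add_eq_zero_right h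

theorem interiorProduct_alternatizeUncurryFin_zero (θ : L →ₗ[R] L [⋀^Fin 0]→ₗ[R] W) (c : L) :
    interiorProduct c (alternatizeUncurryFin θ) = θ c := by
  ext v
  rw [interiorProduct_apply, AlternatingMap.alternatizeUncurryFin_apply, Fin.sum_univ_one]
  simp [Matrix.vecCons]

theorem interiorProduct_alternatizeUncurryFin (θ : L →ₗ[R] L [⋀^Fin (n + 1)]→ₗ[R] W) (c : L) :
    interiorProduct c (alternatizeUncurryFin θ) =
      θ c - alternatizeUncurryFin (interiorProduct c ∘ₗ θ) := by
  ext v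
  rw [AlternatingMap.sub_apply, interiorProduct_apply, AlternatingMap.alternatizeUncurryFin_apply,
    AlternatingMap.alternatizeUncurryFin_apply, Fin.sum_univ_succ, sub_eq_add_neg,
    ← Finset.sum_neg_distrib]
  congr 1
  · simp [Matrix.vecCons]
  · refine Finset.sum_congr rfl fun i _ => ?_
    have h_remove : i.succ.removeNth (Matrix.vecCons c v) = Matrix.vecCons c (i.removeNth v) := by
      funext j
      refine Fin.cases ?_ (fun j => ?_) j <;> simp [Fin.removeNth, Matrix.vecCons]
    rw [h_remove, LinearMap.comp_apply, interiorProduct_apply, Matrix.cons_val_succ, Fin.val_succ,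
      pow_succ, mul_neg_one, neg_smul]

theorem interiorProduct_alternate₂ {f : L →ₗ[R] L →ₗ[R] L [⋀^Fin (n + 1)]→ₗ[R] W} {c : L}
    (h_left : ∀ b, f c b = 0) (h_right : ∀ b, f b c = 0) :
    interiorProduct c (alternate₂ f) = alternate₂ (f.compr₂ (interiorProduct c)) := by
  have h_inner : interiorProduct c ∘ₗ alternatizeUncurryFinLM ∘ₗ f =
      -(alternatizeUncurryFinLM ∘ₗ f.compr₂ (interiorProduct c)) := by
    refine LinearMap.ext fun b => (interiorProduct_alternatizeUncurryFin (f b) c).trans ?_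
    rw [h_right b, zero_sub]
    rfl
  refine (interiorProduct_alternatizeUncurryFin (alternatizeUncurryFinLM ∘ₗ f) c).trans ?_
  rw [h_inner, LinearMap.comp_apply, LinearMap.ext (f := f c) (g := 0) h_left, map_zero, zero_sub]
  exact (congrArg Neg.neg (map_neg alternatizeUncurryFinLM _)).trans (neg_neg _)

end Alternation

section Differential

open AlternatingMap (alternatizeUncurryFin alternatizeUncurryFinLM)

variable {L : Type*} [LieRing L] [LieAlgebra ℝ L] {W : Type*} [AddCommGroup W] [Module ℝ W]
  {n : ℕ}

/-- The bracket of a Lie algebra as a bilinear map. -/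
abbrev lieBilin (L : Type*) [LieRing L] [LieAlgebra ℝ L] : L →ₗ[ℝ] L →ₗ[ℝ] L :=
  LieModule.toEnd ℝ L L

theorem koszulAction_zero (η : L [⋀^Fin n]→ₗ[ℝ] W) : koszulAction 0 η = 0 := by
  ext
  simp [koszulAction]

theorem koszulDifferential_zero_action (η : L [⋀^Fin n]→ₗ[ℝ] W) :
    koszulDifferential 0 n η = koszulBracketTerm η := by
  change alternatizeUncurryFinLM (koszulAction 0 η) + koszulBracketTerm η = _
  rw [koszulAction_zero, map_zero, zero_add]

theorem koszulDifferential_eq (D : L →ₗ[ℝ] Module.End ℝ W) (η : L [⋀^Fin n]→ₗ[ℝ] W) :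
    koszulDifferential D n η =
      alternatizeUncurryFinLM (koszulAction D η) + koszulDifferential 0 n η := by
  rw [koszulDifferential_zero_action]
  rfl

theorem koszulDifferential_zero_action_zero (η : L [⋀^Fin 0]→ₗ[ℝ] W) :
    koszulDifferential 0 0 η = 0 :=
  koszulDifferential_zero_action η

theorem koszulDifferential_zero_action_succ (η : L [⋀^Fin (n + 1)]→ₗ[ℝ] W) :
    koszulDifferential 0 (n + 1) η =
      (-(1 / 2) : ℝ) • alternate₂ ((lieBilin L).compr₂ η.curryLeft) :=
  koszulDifferential_zero_action η

theorem koszulDifferential_zero_action_alternatizeUncurryFin (θ : L →ₗ[ℝ] L [⋀^Fin n]→ₗ[ℝ] W) :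
    koszulDifferential 0 (n + 1) (alternatizeUncurryFin θ) =
      -alternatizeUncurryFin (koszulDifferential 0 n ∘ₗ θ) -
        (1 / 2 : ℝ) • alternate₂ ((lieBilin L).compr₂ θ) := by
  rw [koszulDifferential_zero_action_succ]
  cases n with
  | zero =>
    have h_curry : (alternatizeUncurryFin θ).curryLeft = θ :=
      LinearMap.ext (interiorProduct_alternatizeUncurryFin_zero θ)
    have h_zero : koszulDifferential 0 0 ∘ₗ θ = 0 :=
      LinearMap.ext fun a => koszulDifferential_zero_action_zero (θ a)
    rw [h_curry, h_zero, ← AlternatingMap.alternatizeUncurryFinLM_apply, map_zero]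
    module
  | succ n =>
    let ι : L →ₗ[ℝ] L →ₗ[ℝ] L [⋀^Fin n]→ₗ[ℝ] W := (AlternatingMap.curryLeftLinearMap ∘ₗ θ).flip
    have h_curry : (alternatizeUncurryFin θ).curryLeft = θ - alternatizeUncurryFinLM ∘ₗ ι :=
      LinearMap.ext (interiorProduct_alternatizeUncurryFin θ)
    have h_compr : (lieBilin L).compr₂ (alternatizeUncurryFin θ).curryLeft =
        (lieBilin L).compr₂ θ -
          LinearMap.compRight ℝ alternatizeUncurryFinLM ∘ₗ (lieBilin L).compr₂ ι := by
      rw [h_curry]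
      rfl
    have h_diff : koszulDifferential 0 (n + 1) ∘ₗ θ =
        (-(1 / 2) : ℝ) • (alternate₂ ∘ₗ rotate ((lieBilin L).compr₂ ι)) :=
      LinearMap.ext fun a => koszulDifferential_zero_action_succ (θ a)
    rw [h_compr, h_diff, map_sub, ← alternate₃_eq_alternate₂,
      ← AlternatingMap.alternatizeUncurryFinLM_apply, map_smul, ← alternate₃_eq,
      alternate₃_rotate]
    module

theorem koszulDifferential_alternatizeUncurryFin (D : L →ₗ[ℝ] Module.End ℝ W)
    (θ : L →ₗ[ℝ] L [⋀^Fin n]→ₗ[ℝ] W) :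
    koszulDifferential D (n + 1) (alternatizeUncurryFin θ) =
      -alternatizeUncurryFin (koszulDifferential D n ∘ₗ θ) -
        (1 / 2 : ℝ) • alternate₂ ((lieBilin L).compr₂ θ) := by
  let act : L →ₗ[ℝ] L →ₗ[ℝ] L [⋀^Fin n]→ₗ[ℝ] W :=
    LinearMap.mk₂ ℝ (fun a b => koszulAction D (θ a) b)
      (fun a a' b => by ext v; simp [koszulAction]) (fun r a b => by ext v; simp [koszulAction])
      (fun a b b' => map_add _ _ _) (fun r a b => map_smul _ _ _)
  have h_action :
      koszulAction D (alternatizeUncurryFin θ) = alternatizeUncurryFinLM ∘ₗ act.flip := by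
    ext a v
    simp [koszulAction, AlternatingMap.alternatizeUncurryFin_apply, act]
  have h_diff : koszulDifferential D n ∘ₗ θ =
      alternatizeUncurryFinLM ∘ₗ act + koszulDifferential 0 n ∘ₗ θ :=
    LinearMap.ext fun a => koszulDifferential_eq D (θ a)
  rw [koszulDifferential_eq, koszulDifferential_zero_action_alternatizeUncurryFin, h_action,
    ← alternate₂_eq, alternate₂_flip, h_diff]
  simp only [← AlternatingMap.alternatizeUncurryFinLM_apply, map_add, ← alternate₂_eq]
  abel

theorem koszulDifferential_alternate₂ (D : L →ₗ[ℝ] Module.End ℝ W)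
    (f : L →ₗ[ℝ] L →ₗ[ℝ] L [⋀^Fin n]→ₗ[ℝ] W) :
    koszulDifferential D (n + 2) (alternate₂ f) = alternate₂ (f.compr₂ (koszulDifferential D n)) +
      (1 / 2 : ℝ) • alternate₃ ((lieBilin L).compr₂ (f.flip - f)) := by
  have h_inner : koszulDifferential D (n + 1) ∘ₗ alternatizeUncurryFinLM ∘ₗ f =
      -(alternatizeUncurryFinLM ∘ₗ f.compr₂ (koszulDifferential D n)) -
        (1 / 2 : ℝ) • (alternate₂ ∘ₗ rotate ((lieBilin L).compr₂ f.flip)) :=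
    LinearMap.ext fun a => koszulDifferential_alternatizeUncurryFin D (f a)
  have h_compr : (lieBilin L).compr₂ (f.flip - f) =
      (lieBilin L).compr₂ f.flip - (lieBilin L).compr₂ f := rfl
  have h_bracket : alternate₂ ((lieBilin L).compr₂ (alternatizeUncurryFinLM ∘ₗ f)) =
      alternate₃ ((lieBilin L).compr₂ f) := rfl
  refine (koszulDifferential_alternatizeUncurryFin D (alternatizeUncurryFinLM ∘ₗ f)).trans ?_
  rw [h_inner, h_bracket, h_compr, ← AlternatingMap.alternatizeUncurryFinLM_apply, map_sub,
    map_neg, map_smul, ← alternate₂_eq, ← alternate₃_eq, alternate₃_rotate, map_sub]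
  module

theorem koszulDifferential_compAlternatingMap {W' : Type*} [AddCommGroup W'] [Module ℝ W']
    {D : L →ₗ[ℝ] Module.End ℝ W} {D' : L →ₗ[ℝ] Module.End ℝ W'} (T : W →ₗ[ℝ] W')
    (hT : ∀ a w, T (D a w) = D' a (T w)) (η : L [⋀^Fin n]→ₗ[ℝ] W) :
    koszulDifferential D' n (T.compAlternatingMap η) =
      T.compAlternatingMap (koszulDifferential D n η) := by
  ext a
  cases n with
  | zero => simp only [koszulDifferential_zero_apply, LinearMap.compAlternatingMap_apply, hT]
  | succ n =>
    simp only [koszulDifferential_apply, LinearMap.compAlternatingMap_apply, map_add, map_sum,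
      map_smul, hT]

theorem koszulDifferential_compLinearMap {L' : Type*} [LieRing L'] [LieAlgebra ℝ L']
    (D : L →ₗ[ℝ] Module.End ℝ W) (φ : L' →ₗ⁅ℝ⁆ L) (η : L [⋀^Fin (n + 1)]→ₗ[ℝ] W) :
    koszulDifferential (D ∘ₗ φ.toLinearMap) (n + 1) (η.compLinearMap φ.toLinearMap) =
      (koszulDifferential D (n + 1) η).compLinearMap φ.toLinearMap := by
  ext a
  simp only [AlternatingMap.compLinearMap_apply, koszulDifferential_apply]
  congr 1
  refine Finset.sum_congr rfl fun i _ => Finset.sum_congr rfl fun j _ => ?_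
  congr 2
  funext k
  refine Fin.cases ?_ (fun k => ?_) k
  · exact LieHom.map_lie φ _ _
  · rfl

/-- Cartan's formula; the Lie derivative along a central element is just its action on values. -/
theorem interiorProduct_koszulDifferential_of_central (D : L →ₗ[ℝ] Module.End ℝ W)
    (η : L [⋀^Fin (n + 2)]→ₗ[ℝ] W) {c : L} (hc : ∀ a : L, ⁅c, a⁆ = 0) :
    interiorProduct c (koszulDifferential D (n + 2) η) =
      (D c).compAlternatingMap η - koszulDifferential D (n + 1) (interiorProduct c η) := by
  have hc' : ∀ a : L, ⁅a, c⁆ = 0 := fun a => by rw [← lie_skew, hc, neg_zero]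
  have h_bracket : interiorProduct c (koszulDifferential 0 (n + 2) η) =
      -koszulDifferential 0 (n + 1) (interiorProduct c η) := by
    have h_compr : ((lieBilin L).compr₂ η.curryLeft).compr₂ (interiorProduct c) =
        -(lieBilin L).compr₂ (interiorProduct c η).curryLeft := by
      ext1 a; ext1 b
      exact interiorProduct_swap η ⁅a, b⁆ c
    rw [koszulDifferential_zero_action_succ, koszulDifferential_zero_action_succ, map_smul,
      interiorProduct_alternate₂ (fun b => (congrArg η.curryLeft (hc b)).trans (map_zero _))
        (fun b => (congrArg η.curryLeft (hc' b)).trans (map_zero _)),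
      h_compr, map_neg, smul_neg]
  have h_action : interiorProduct c ∘ₗ koszulAction D η = koszulAction D (interiorProduct c η) := by
    ext a v
    rfl
  rw [koszulDifferential_eq, koszulDifferential_eq D (interiorProduct c η), map_add, h_bracket,
    AlternatingMap.alternatizeUncurryFinLM_apply, interiorProduct_alternatizeUncurryFin, h_action]
  change (D c).compAlternatingMap η - _ + _ = _
  rw [AlternatingMap.alternatizeUncurryFinLM_apply]
  abel

end Differential

section Wedge

open AlternatingMap (alternatizeUncurryFin alternatizeUncurryFinLM)

variable {L : Type*} [LieRing L] [LieAlgebra ℝ L] {B : Type*} [Ring B] [Algebra ℝ B] {n : ℕ}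

/-- Left multiplication of forms by elements of the algebra of coefficients. -/
def formMul (B : Type*) [Ring B] [Algebra ℝ B] (n : ℕ) :
    B →ₗ[ℝ] (L [⋀^Fin n]→ₗ[ℝ] B) →ₗ[ℝ] L [⋀^Fin n]→ₗ[ℝ] B :=
  LinearMap.mk₂ ℝ (fun b η => (LinearMap.mulLeft ℝ b).compAlternatingMap η)
    (fun b b' η => by ext v; simp [add_mul]) (fun r b η => by ext v; simp)
    (fun b η η' => by ext v; simp) (fun r b η => by ext v; simp)

@[simp] theorem formMul_apply (b : B) (η : L [⋀^Fin n]→ₗ[ℝ] B) (v : Fin n → L) :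
    formMul B n b η v = b * η v := rfl

/-- The product of a bilinear map `K` with a form, alternated. For skew-symmetric `K` this is twice
the wedge product of the `2`-form `K` with the form. -/
def bilinWedge (K : L →ₗ[ℝ] L →ₗ[ℝ] B) :
    (L [⋀^Fin n]→ₗ[ℝ] B) →ₗ[ℝ] L [⋀^Fin (n + 2)]→ₗ[ℝ] B where
  toFun η := alternate₂ (K.compr₂ ((formMul B n).flip η))
  map_add' η η' := by
    rw [← map_add alternate₂]
    congr 1
    ext
    simp
  map_smul' r η := by
    rw [RingHom.id_apply, ← map_smul alternate₂]
    congr 1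
    ext
    simp

theorem bilinWedge_apply (K : L →ₗ[ℝ] L →ₗ[ℝ] B) (η : L [⋀^Fin n]→ₗ[ℝ] B) :
    bilinWedge K η = alternate₂ (K.compr₂ ((formMul B n).flip η)) := rfl

variable {D : L →ₗ[ℝ] Module.End ℝ B} {K : L →ₗ[ℝ] L →ₗ[ℝ] B}

theorem koszulDifferential_formMul (hD : ∀ a x y, D a (x * y) = D a x * y + x * D a y) (b : B)
    (η : L [⋀^Fin n]→ₗ[ℝ] B) :
    koszulDifferential D n (formMul B n b η) =
      alternatizeUncurryFin ((formMul B n).flip η ∘ₗ D.flip b) +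
        formMul B (n + 1) b (koszulDifferential D n η) := by
  have h_action : koszulAction D (formMul B n b η) =
      (formMul B n).flip η ∘ₗ D.flip b + formMul B n b ∘ₗ koszulAction D η := by
    ext a v
    simp [koszulAction, hD]
  have h_bracket : koszulDifferential 0 n (formMul B n b η) =
      formMul B (n + 1) b (koszulDifferential 0 n η) :=
    koszulDifferential_compAlternatingMap (LinearMap.mulLeft ℝ b) (by simp) η
  have h_mul : alternatizeUncurryFinLM (formMul B n b ∘ₗ koszulAction D η) =
      formMul B (n + 1) b (alternatizeUncurryFinLM (koszulAction D η)) := by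
    ext v
    simp only [AlternatingMap.alternatizeUncurryFinLM_apply,
      AlternatingMap.alternatizeUncurryFin_apply, LinearMap.comp_apply, formMul_apply,
      Finset.mul_sum, mul_smul_comm]
  rw [koszulDifferential_eq, koszulDifferential_eq D η, h_action, h_bracket, map_add, h_mul,
    map_add, AlternatingMap.alternatizeUncurryFinLM_apply]
  abel

theorem koszulDifferential_bilinWedge (hD : ∀ a x y, D a (x * y) = D a x * y + x * D a y)
    (hK : ∀ a b, K b a = -K a b)
    (bianchi : ∀ a b c, D a (K b c) + D b (K c a) + D c (K a b) =
      K ⁅a, b⁆ c + K ⁅b, c⁆ a + K ⁅c, a⁆ b) (η : L [⋀^Fin n]→ₗ[ℝ] B) :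
    koszulDifferential D (n + 2) (bilinWedge K η) = bilinWedge K (koszulDifferential D n η) := by
  let m : B →ₗ[ℝ] L [⋀^Fin n]→ₗ[ℝ] B := (formMul B n).flip η
  let DK : L →ₗ[ℝ] L →ₗ[ℝ] L →ₗ[ℝ] B := K.compr₂ D.flip
  let bracketK : L →ₗ[ℝ] L →ₗ[ℝ] L →ₗ[ℝ] B := (lieBilin L).compr₂ K
  have h_cyclic : alternate₃ (DK.compr₂ (LinearMap.compRight ℝ m)) =
      alternate₃ (bracketK.compr₂ (LinearMap.compRight ℝ m)) := by
    refine sub_eq_zero.1 ((map_sub alternate₃ _ _).symm.trans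
      (alternate₃_eq_zero_of_cyclic_sum fun a b c => ?_))
    have h := congrArg m (bianchi a b c)
    simp only [map_add] at h
    change m (D c (K a b)) - m (K ⁅a, b⁆ c) + (m (D a (K b c)) - m (K ⁅b, c⁆ a)) +
      (m (D b (K c a)) - m (K ⁅c, a⁆ b)) = 0
    rw [← sub_eq_zero_of_eq h]
    abel
  have h_leibniz : (K.compr₂ m).compr₂ (koszulDifferential D n) =
      LinearMap.compRight ℝ alternatizeUncurryFinLM ∘ₗ
        DK.compr₂ (LinearMap.compRight ℝ m) +
      K.compr₂ ((formMul B (n + 1)).flip (koszulDifferential D n η)) := by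
    ext1 a; ext1 b
    exact koszulDifferential_formMul hD (K a b) η
  have h_skew : (K.compr₂ m).flip - K.compr₂ m = (-2 : ℝ) • K.compr₂ m := by
    ext1 a; ext1 b
    change m (K b a) - m (K a b) = (-2 : ℝ) • m (K a b)
    rw [hK, map_neg]
    module
  have h_bracket : (lieBilin L).compr₂ ((-2 : ℝ) • K.compr₂ m) =
      (-2 : ℝ) • bracketK.compr₂ (LinearMap.compRight ℝ m) := rfl
  rw [bilinWedge_apply, koszulDifferential_alternate₂, h_leibniz, h_skew, h_bracket, map_add,
    ← alternate₃_eq_alternate₂, h_cyclic, map_smul, bilinWedge_apply]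
  module

end Wedge

section AlternatingPower

theorem bijective_cycleRange_mul_decomposeFin (n : ℕ) :
    Function.Bijective fun q : Fin (n + 1) × Equiv.Perm (Fin n) =>
      q.1.cycleRange⁻¹ * Equiv.Perm.decomposeFin.symm (0, q.2) := by
  rw [Fintype.bijective_iff_injective_and_card]
  refine ⟨fun q r h => ?_, by simp [Fintype.card_perm, Nat.factorial_succ]⟩
  have h_fst : q.1 = r.1 := by simpa [Equiv.Perm.inv_def] using DFunLike.congr_fun h 0
  refine Prod.ext h_fst (Equiv.ext fun j => ?_)
  have h_succ := DFunLike.congr_fun h j.succ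
  simpa [Equiv.Perm.inv_def, h_fst] using h_succ

theorem alternatization_apply_succ {R L W : Type*} [CommRing R] [AddCommGroup L] [Module R L]
    [AddCommGroup W] [Module R W] {n : ℕ} (m : MultilinearMap R (fun _ : Fin (n + 1) => L) W)
    (v : Fin (n + 1) → L) :
    MultilinearMap.alternatization m v = ∑ i : Fin (n + 1), (-1 : ℤ) ^ (i : ℕ) •
      MultilinearMap.alternatization (m.curryLeft (v i)) (i.removeNth v) := by
  rw [MultilinearMap.alternatization_apply, ← (bijective_cycleRange_mul_decomposeFin n).sum_comp,
    Fintype.sum_prod_type]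
  refine Finset.sum_congr rfl fun i _ => ?_
  rw [MultilinearMap.alternatization_apply, Finset.smul_sum]
  refine Finset.sum_congr rfl fun σ _ => ?_
  have h_sign : (Equiv.Perm.sign (i.cycleRange⁻¹ * Equiv.Perm.decomposeFin.symm (0, σ)) : ℤ) =
      (-1) ^ (i : ℕ) * Equiv.Perm.sign σ := by simp
  rw [Units.smul_def, Units.smul_def, h_sign, mul_smul, MultilinearMap.domDomCongr_apply,
    MultilinearMap.domDomCongr_apply, MultilinearMap.curryLeft_apply]
  congr 3
  funext j
  refine Fin.cases ?_ (fun j => ?_) j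
  · simp [Equiv.Perm.inv_def, Fin.cycleRange_symm_zero]
  · simp [Equiv.Perm.inv_def, Fin.removeNth]

variable {L : Type*} [LieRing L] [LieAlgebra ℝ L] {B : Type*} [Ring B] [Algebra ℝ B]

theorem pairProduct_apply (K : L →ₗ[ℝ] L →ₗ[ℝ] B) (p : ℕ) (a : Fin (2 * p) → L) :
    pairProduct K p a = (List.ofFn fun i : Fin p =>
      K (a ⟨2 * i, by omega⟩) (a ⟨2 * i + 1, by omega⟩)).prod := rfl

theorem pairProduct_succ (K : L →ₗ[ℝ] L →ₗ[ℝ] B) (p : ℕ) (x y : L) (a : Fin (2 * p) → L) :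
    pairProduct K (p + 1) (Fin.cons x (Fin.cons y a) : Fin (2 * p + 1 + 1) → L) =
      K x y * pairProduct K p a := by
  rw [pairProduct_apply, List.ofFn_succ, List.prod_cons]
  rfl

theorem alternatization_pairProduct_succ (K : L →ₗ[ℝ] L →ₗ[ℝ] B) (p : ℕ) :
    MultilinearMap.alternatization (pairProduct K (p + 1)) =
      bilinWedge K (MultilinearMap.alternatization (pairProduct K p)) := by
  ext a
  refine (alternatization_apply_succ (n := 2 * p + 1) _ a).trans ?_
  rw [bilinWedge_apply, alternate₂_eq, AlternatingMap.alternatizeUncurryFinLM_apply,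
    AlternatingMap.alternatizeUncurryFin_apply]
  refine Finset.sum_congr rfl fun i _ => congrArg _ ?_
  rw [alternatization_apply_succ, LinearMap.comp_apply,
    AlternatingMap.alternatizeUncurryFinLM_apply, AlternatingMap.alternatizeUncurryFin_apply]
  refine Finset.sum_congr rfl fun j _ => congrArg _ ?_
  rw [LinearMap.compr₂_apply, LinearMap.flip_apply, formMul_apply,
    MultilinearMap.alternatization_apply, MultilinearMap.alternatization_apply, Finset.mul_sum]
  refine Finset.sum_congr rfl fun σ _ => ?_
  rw [mul_smul_comm]
  exact congrArg _ (pairProduct_succ K p _ _ _)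

theorem alternatingPower_zero (K : L →ₗ[ℝ] L →ₗ[ℝ] B) (a : Fin (2 * 0) → L) :
    alternatingPower K 0 a = 1 := by
  rw [alternatingPower_apply]
  simp

theorem alternatingPower_succ (K : L →ₗ[ℝ] L →ₗ[ℝ] B) (p : ℕ) :
    alternatingPower K (p + 1) = (1 / 2 : ℝ) • bilinWedge K (alternatingPower K p) := by
  rw [alternatingPower, alternatingPower, alternatization_pairProduct_succ, map_smul, smul_smul]
  congr 1
  rw [pow_succ']
  ring

theorem alternatingPower_congr {L' : Type*} [LieRing L'] [LieAlgebra ℝ L']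
    {K : L →ₗ[ℝ] L →ₗ[ℝ] B} {K' : L' →ₗ[ℝ] L' →ₗ[ℝ] B} {p : ℕ} {a : Fin (2 * p) → L}
    {a' : Fin (2 * p) → L'} (h : ∀ i j, K (a i) (a j) = K' (a' i) (a' j)) :
    alternatingPower K p a = alternatingPower K' p a' := by
  simp only [alternatingPower_apply, h]

theorem alternatingPower_eq_zero_of_finrank_lt {U : Type*} [AddCommGroup U] [Module ℝ U]
    [FiniteDimensional ℝ U] {K : L →ₗ[ℝ] L →ₗ[ℝ] B} {q : L →ₗ[ℝ] U}
    (hq : Function.Surjective q)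
    (hK : ∀ a a' b b', q a = q a' → q b = q b' → K a b = K a' b') {p : ℕ}
    (hp : Module.finrank ℝ U < 2 * p) : alternatingPower K p = 0 := by
  ext a
  obtain ⟨ε, hε⟩ := q.exists_rightInverse_of_surjective (LinearMap.range_eq_top.2 hq)
  have h_lift : ∀ u, q (ε u) = u := DFunLike.congr_fun hε
  have h_descend : alternatingPower K p a = (alternatingPower K p).compLinearMap ε (q ∘ a) :=
    alternatingPower_congr fun i j => hK _ _ _ _ (h_lift (q (a i))).symm (h_lift (q (a j))).symm
  have h_dependent : ¬ LinearIndependent ℝ (q ∘ a) := fun h_indep => by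
    have h_card := h_indep.fintype_card_le_finrank
    rw [Fintype.card_fin] at h_card
    omega
  exact h_descend.trans (AlternatingMap.map_linearDependent _ _ h_dependent)

theorem map_alternatingPower {B' : Type*} [Ring B'] [Algebra ℝ B'] (f : B →ₐ[ℝ] B')
    (K : L →ₗ[ℝ] L →ₗ[ℝ] B) (p : ℕ) (a : Fin (2 * p) → L) :
    f (alternatingPower K p a) = alternatingPower (K.compr₂ f.toLinearMap) p a := by
  simp only [alternatingPower_apply, map_smul, map_sum, map_zsmul, map_list_prod, List.map_ofFn]
  rfl

theorem koszulDifferential_alternatingPower {D : L →ₗ[ℝ] Module.End ℝ B} {K : L →ₗ[ℝ] L →ₗ[ℝ] B}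
    (hD : ∀ a x y, D a (x * y) = D a x * y + x * D a y)
    (hK : ∀ a b, K b a = -K a b)
    (bianchi : ∀ a b c, D a (K b c) + D b (K c a) + D c (K a b) =
      K ⁅a, b⁆ c + K ⁅b, c⁆ a + K ⁅c, a⁆ b) (p : ℕ) :
    koszulDifferential D (2 * p) (alternatingPower K p) = 0 := by
  induction p with
  | zero =>
    ext a
    refine (koszulDifferential_zero_apply D _ a).trans ?_
    rw [alternatingPower_zero]
    simpa using hD (a 0) 1 1
  | succ p ih =>
    rw [alternatingPower_succ]
    refine ((koszulDifferential D (2 * p + 2)).map_smul _ _).trans ?_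
    rw [koszulDifferential_bilinWedge hD hK bianchi, ih, map_zero, smul_zero]

end AlternatingPower

namespace RLinearConnection

variable {L : Type*} [LieRing L] [LieAlgebra ℝ L] {R : Type*} [CommRing R] [Algebra ℝ R]
  {δ : L →ₗ⁅ℝ⁆ Derivation ℝ R R} {W : Type*} [AddCommGroup W]
  [Module ℝ W] [Module R W]

/-- The connection induced on functionals, `c ↦ δ_a ∘ c - c ∘ ∇_a`. -/
def dual (D : RLinearConnection δ W) (a : L) (c : W →ₗ[R] R) : W →ₗ[R] R where
  toFun w := δ a (c w) - c (D a w)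
  map_add' v w := by simp only [map_add]; abel
  map_smul' f w := by
    simp only [D.leibniz, map_add, map_smul, smul_eq_mul, Derivation.leibniz, RingHom.id_apply]
    ring

theorem dual_apply (D : RLinearConnection δ W) (a : L) (c : W →ₗ[R] R) (w : W) :
    D.dual a c w = δ a (c w) - c (D a w) := rfl

variable [IsScalarTower ℝ R W]

/-- The connection induced on endomorphisms, `φ ↦ ∇_a ∘ φ - φ ∘ ∇_a`. -/
def adjoint (D : RLinearConnection δ W) : L →ₗ[ℝ] Module.End ℝ (Module.End R W) :=
  LinearMap.mk₂ ℝ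
    (fun a φ =>
      { toFun := fun w => D a (φ w) - φ (D a w)
        map_add' := fun v w => by simp only [map_add]; abel
        map_smul' := fun f w => by
          simp only [D.leibniz, map_add, map_smul, RingHom.id_apply, smul_sub]
          abel })
    (fun a a' φ => by ext w; simp; abel)
    (fun r a φ => by ext w; simp [smul_sub, LinearMap.map_smul_of_tower])
    (fun a φ ψ => by ext w; simp; abel)
    (fun r a φ => by ext w; simp [smul_sub])

@[simp] theorem adjoint_apply (D : RLinearConnection δ W) (a : L) (φ : Module.End R W) (w : W) :
    D.adjoint a φ w = D a (φ w) - φ (D a w) := rfl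

theorem adjoint_mul (D : RLinearConnection δ W) (a : L) (φ ψ : Module.End R W) :
    D.adjoint a (φ * ψ) = D.adjoint a φ * ψ + φ * D.adjoint a ψ := by
  ext w
  simp

theorem adjoint_smul (D : RLinearConnection δ W) (a : L) (f : R) (φ : Module.End R W) :
    D.adjoint a (f • φ) = f • D.adjoint a φ + δ a f • φ := by
  ext w
  simp only [adjoint_apply, LinearMap.smul_apply, LinearMap.add_apply, D.leibniz, smul_sub]
  abel

theorem adjoint_smulRight (D : RLinearConnection δ W) (a : L) (c : W →ₗ[R] R) (s : W) :
    D.adjoint a (c.smulRight s) = c.smulRight (D a s) + (D.dual a c).smulRight s := by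
  ext w
  simp only [adjoint_apply, LinearMap.smulRight_apply, LinearMap.add_apply, dual_apply, D.leibniz,
    sub_smul]
  abel

theorem curvature_skew (D : RLinearConnection δ W) (a b : L) :
    D.curvature b a = -D.curvature a b := by
  ext w
  simp only [curvature_apply, LinearMap.neg_apply]
  rw [← lie_skew a b, map_neg, LinearMap.neg_apply]
  abel

theorem bianchi (D : RLinearConnection δ W) (a b c : L) :
    D.adjoint a (D.curvature b c) + D.adjoint b (D.curvature c a) + D.adjoint c (D.curvature a b) =
      D.curvature ⁅a, b⁆ c + D.curvature ⁅b, c⁆ a + D.curvature ⁅c, a⁆ b := by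
  ext w
  have jacobi : ⁅⁅a, b⁆, c⁆ + ⁅⁅b, c⁆, a⁆ + ⁅⁅c, a⁆, b⁆ = 0 := by
    rw [← lie_skew ⁅a, b⁆ c, ← lie_skew ⁅b, c⁆ a, ← lie_skew ⁅c, a⁆ b, ← neg_eq_zero,
      ← lie_jacobi a b c]
    abel
  have h : D ⁅⁅a, b⁆, c⁆ w + D ⁅⁅b, c⁆, a⁆ w + D ⁅⁅c, a⁆, b⁆ w = 0 := by
    rw [← LinearMap.add_apply, ← LinearMap.add_apply, ← map_add, ← map_add, jacobi, map_zero,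
      LinearMap.zero_apply]
  simp only [LinearMap.add_apply, adjoint_apply, curvature_apply, map_sub]
  rw [← sub_eq_zero, ← h]
  abel

theorem koszulDifferential_alternatingPower_curvature (D : RLinearConnection δ W) (p : ℕ) :
    koszulDifferential D.adjoint (2 * p) (alternatingPower D.curvature p) = 0 :=
  koszulDifferential_alternatingPower D.adjoint_mul D.curvature_skew D.bianchi p

theorem curvature_smul_left [Module R L] {D : RLinearConnection δ W}
    (hD : ∀ (g : R) a w, D (g • a) w = g • D a w)
    (h_lie : ∀ (b a : L) (g : R), ⁅b, g • a⁆ = g • ⁅b, a⁆ + δ b g • a) (g : R) (a b : L) :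
    D.curvature (g • a) b = g • D.curvature a b := by
  have h_smul_lie : ⁅g • a, b⁆ = g • ⁅a, b⁆ - δ b g • a := by
    rw [← lie_skew, h_lie, ← lie_skew a b, smul_neg]
    abel
  ext1 w
  simp only [LinearMap.smul_apply, curvature_apply, h_smul_lie, map_sub, LinearMap.sub_apply, hD,
    D.leibniz, smul_sub]
  abel

end RLinearConnection

/-- The action of `L` on `R` by the linear operators underlying a family of derivations, as the
coefficients of the Koszul differential of `R`-valued forms. -/
def derivationAction {L : Type*} [LieRing L] [LieAlgebra ℝ L] {R : Type*} [CommRing R] [Algebra ℝ R]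
    (δ : L →ₗ⁅ℝ⁆ Derivation ℝ R R) : L →ₗ[ℝ] Module.End ℝ R where
  toFun a := (δ a : R →ₗ[ℝ] R)
  map_add' a b := by rw [map_add]; rfl
  map_smul' r a := by rw [map_smul]; rfl

section Sections

variable {E : Type*} [NormedAddCommGroup E] [NormedSpace ℝ E] [FiniteDimensional ℝ E]
  {H : Type*} [TopologicalSpace H] {I : ModelWithCorners ℝ E H}
  {N : Type*} [TopologicalSpace N] [ChartedSpace H N] [IsManifold I ∞ N] [T2Space N]
  {F : Type*} [NormedAddCommGroup F] [NormedSpace ℝ F] [FiniteDimensional ℝ F]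
  {V : N → Type*} [TopologicalSpace (TotalSpace F V)] [∀ x, AddCommGroup (V x)]
  [∀ x, Module ℝ (V x)] [∀ x, TopologicalSpace (V x)] [FiberBundle F V] [VectorBundle ℝ F V]
  [ContMDiffVectorBundle ∞ F V I]

theorem exists_local_dual_frame (x : N) :
    ∃ (r : ℕ) (χ : C^∞⟮I, N; 𝓘(ℝ, ℝ), ℝ⟯) (s : Fin r → Cₛ^∞⟮I; F, V⟯)
      (c : Fin r → Cₛ^∞⟮I; F, V⟯ →ₗ[C^∞⟮I, N; 𝓘(ℝ, ℝ), ℝ⟯] C^∞⟮I, N; 𝓘(ℝ, ℝ), ℝ⟯),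
      (∀ᶠ y in 𝓝 x, χ y = 1) ∧ ∀ σ, χ • σ = ∑ i, c i σ • s i := by
  obtain ⟨r, χ, s, k, hχ, hk, h⟩ := exists_cutoff_frame (F := F) (V := V) I x
  exact ⟨r, χ, s, fun i =>
    { toFun := fun σ => smoothFun (fun y => k i y (σ y)) ((hk i).comp σ.contMDiff)
      map_add' := fun σ τ => ContMDiffMap.ext fun y => (k i y).map_add _ _
      map_smul' := fun f σ => ContMDiffMap.ext fun y => (k i y).map_smul _ _ },
    hχ, cutoff_frame_sections hk h⟩

theorem map_eq_of_apply_eq {X : Type*} [AddCommGroup X] [Module ℝ X] {x : N}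
    (ψ : Cₛ^∞⟮I; F, V⟯ →+ X)
    (hψ : ∀ (f : C^∞⟮I, N; 𝓘(ℝ, ℝ), ℝ⟯) σ, ψ (f • σ) = f x • ψ σ)
    {σ τ : Cₛ^∞⟮I; F, V⟯} (h : σ x = τ x) : ψ σ = ψ τ := by
  obtain ⟨r, χ, s, k, hχ, hk, hframe⟩ := exists_cutoff_frame (F := F) (V := V) I x
  have h_expand : ∀ σ : Cₛ^∞⟮I; F, V⟯, ψ σ = ∑ i, k i x (σ x) • ψ (s i) := by
    intro σ
    have h_cutoff := congrArg ψ (cutoff_frame_sections hk hframe σ)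
    simpa only [map_sum, hψ, hχ.self_of_nhds, one_smul, smoothFun_apply] using h_cutoff
  rw [h_expand σ, h_expand τ, h]

theorem smoothTrace_smulRight
    (c : Cₛ^∞⟮I; F, V⟯ →ₗ[C^∞⟮I, N; 𝓘(ℝ, ℝ), ℝ⟯] C^∞⟮I, N; 𝓘(ℝ, ℝ), ℝ⟯) (s : Cₛ^∞⟮I; F, V⟯) :
    smoothTrace (c.smulRight s) = c s := by
  ext x
  have : FiniteDimensional ℝ (V x) := VectorBundle.finiteDimensional ℝ F V x
  let evalAt : C^∞⟮I, N; 𝓘(ℝ, ℝ), ℝ⟯ →+ ℝ := (ContMDiffMap.evalRingHom x).toAddMonoidHom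
  have hc : ∀ {σ τ : Cₛ^∞⟮I; F, V⟯}, σ x = τ x → c σ x = c τ x :=
    map_eq_of_apply_eq (evalAt.comp c.toAddMonoidHom)
      fun f σ => congrArg evalAt (c.map_smul f σ)
  obtain ⟨ε, hε⟩ := exists_section_extension (F := F) (V := V) I x
  let ℓ : V x →ₗ[ℝ] ℝ :=
    { toFun := fun v => c (ε v) x
      map_add' := fun v w => by rw [map_add, map_add]; rfl
      map_smul' := fun r v => by rw [map_smul, LinearMap.map_smul_of_tower]; rfl }
  have h_fibre : fibreEnd (c.smulRight s) x = ℓ.smulRight (s x) := by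
    ext v
    have h := fibreEnd_apply (c.smulRight s) x (ε v)
    rwa [hε] at h
  rw [smoothTrace_apply, h_fibre, LinearMap.trace_smulRight]
  exact hc (hε (s x))

/-- The value at `x` of an endomorphism of the module of sections, as a homomorphism of
algebras. -/
def fibreEndAlgHom (x : N) :
    Module.End C^∞⟮I, N; 𝓘(ℝ, ℝ), ℝ⟯ Cₛ^∞⟮I; F, V⟯ →ₐ[ℝ] Module.End ℝ (V x) :=
  AlgHom.ofLinearMap
    { toFun := fun φ => fibreEnd φ x
      map_add' := fun _ _ => rfl
      map_smul' := fun _ _ => rfl }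
    (LinearMap.ext fun v => (exists_section_extension (F := F) (V := V) I x).choose_spec v)
    fun φ _ => LinearMap.ext fun _ => (fibreEnd_apply φ x _).symm

namespace RLinearConnection

variable {L : Type*} [LieRing L] [LieAlgebra ℝ L]
  {δ : L →ₗ⁅ℝ⁆ Derivation ℝ C^∞⟮I, N; 𝓘(ℝ, ℝ), ℝ⟯ C^∞⟮I, N; 𝓘(ℝ, ℝ), ℝ⟯}

theorem smoothTrace_adjoint_smulRight (D : RLinearConnection δ Cₛ^∞⟮I; F, V⟯) (a : L)
    (c : Cₛ^∞⟮I; F, V⟯ →ₗ[C^∞⟮I, N; 𝓘(ℝ, ℝ), ℝ⟯] C^∞⟮I, N; 𝓘(ℝ, ℝ), ℝ⟯) (s : Cₛ^∞⟮I; F, V⟯) :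
    smoothTrace (D.adjoint a (c.smulRight s)) = δ a (smoothTrace (c.smulRight s)) := by
  rw [adjoint_smulRight, map_add, smoothTrace_smulRight, smoothTrace_smulRight,
    smoothTrace_smulRight, dual_apply, add_sub_cancel]

/-- After multiplication with a cutoff function an endomorphism is a sum of endomorphisms of rank
one, and the defect in the Leibniz rule cancels. -/
theorem smoothTrace_adjoint (D : RLinearConnection δ Cₛ^∞⟮I; F, V⟯) (a : L)
    (φ : Module.End C^∞⟮I, N; 𝓘(ℝ, ℝ), ℝ⟯ Cₛ^∞⟮I; F, V⟯) :
    smoothTrace (D.adjoint a φ) = δ a (smoothTrace φ) := by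
  ext x
  obtain ⟨r, χ, s, c, hχ, hframe⟩ := exists_local_dual_frame (I := I) (F := F) (V := V) x
  have h_rank_one : χ • φ = ∑ i, (c i).smulRight (φ (s i)) := by
    ext1 σ
    rw [LinearMap.smul_apply, ← map_smul, hframe, map_sum, LinearMap.sum_apply]
    exact Finset.sum_congr rfl fun i _ => φ.map_smul _ _
  have h_cutoff : smoothTrace (D.adjoint a (χ • φ)) = δ a (smoothTrace (χ • φ)) := by
    simp only [h_rank_one, map_sum, smoothTrace_adjoint_smulRight]
  rw [adjoint_smul, map_add, map_smul, map_smul, map_smul, smul_eq_mul χ (smoothTrace φ),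
    Derivation.leibniz, smul_eq_mul (smoothTrace φ), mul_comm (smoothTrace φ), smul_eq_mul (δ a χ),
    add_left_inj] at h_cutoff
  have h_at : χ x * smoothTrace (D.adjoint a φ) x = χ x * δ a (smoothTrace φ) x :=
    DFunLike.congr_fun h_cutoff x
  rwa [hχ.self_of_nhds, one_mul, one_mul] at h_at

theorem koszulDifferential_chernForm (D : RLinearConnection δ Cₛ^∞⟮I; F, V⟯) (p : ℕ) :
    koszulDifferential (derivationAction δ) (2 * p) (D.chernForm p) = 0 := by
  refine (koszulDifferential_compAlternatingMap (smoothTrace.restrictScalars ℝ)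
    D.smoothTrace_adjoint _).trans ?_
  rw [D.koszulDifferential_alternatingPower_curvature p]
  exact AlternatingMap.ext fun _ => smoothTrace.map_zero

/-- The curvature at a point, with values in the endomorphisms of the fibre. -/
def fibreCurvature (D : RLinearConnection δ Cₛ^∞⟮I; F, V⟯) (x : N) :
    L →ₗ[ℝ] L →ₗ[ℝ] Module.End ℝ (V x) :=
  D.curvature.compr₂ (fibreEndAlgHom x).toLinearMap

theorem fibreCurvature_apply (D : RLinearConnection δ Cₛ^∞⟮I; F, V⟯) (x : N) (a b : L)
    (σ : Cₛ^∞⟮I; F, V⟯) : D.fibreCurvature x a b (σ x) = D.curvature a b σ x :=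
  fibreEnd_apply _ x σ

theorem fibreCurvature_skew (D : RLinearConnection δ Cₛ^∞⟮I; F, V⟯) (x : N) (a b : L) :
    D.fibreCurvature x b a = -D.fibreCurvature x a b :=
  (congrArg (fibreEndAlgHom x) (D.curvature_skew a b)).trans (map_neg _ _)

theorem chernForm_apply_apply (D : RLinearConnection δ Cₛ^∞⟮I; F, V⟯) (p : ℕ)
    (a : Fin (2 * p) → L) (x : N) :
    D.chernForm p a x = LinearMap.trace ℝ (V x) (alternatingPower (D.fibreCurvature x) p a) :=
  congrArg (LinearMap.trace ℝ (V x)) (map_alternatingPower (fibreEndAlgHom x) D.curvature p a)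

end RLinearConnection

end Sections

section Integral

theorem continuous_slice {T P X : Type*} [TopologicalSpace T] [TopologicalSpace P]
    [TopologicalSpace X] {s : Set P} {g : T × P → X} (hg : ContinuousOn g (Set.univ ×ˢ s)) {y : P}
    (hy : y ∈ s) : Continuous fun t => g (t, y) :=
  hg.comp_continuous (Continuous.prodMk_left y) fun _ => ⟨trivial, hy⟩

variable {P : Type*} [NormedAddCommGroup P] [NormedSpace ℝ P] {s : Set P} {G : ℝ × P → ℝ}

theorem hasFDerivAt_slice (hs : IsOpen s) (hG : ContDiffOn ℝ ∞ G (Set.univ ×ˢ s)) {y : P}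
    (hy : y ∈ s) (t : ℝ) :
    HasFDerivAt (fun p => G (t, p)) ((fderiv ℝ G (t, y)).comp (.inr ℝ ℝ P)) y :=
  ((hG.contDiffAt ((isOpen_univ.prod hs).mem_nhds ⟨trivial, hy⟩)).differentiableAt
    (by simp)).hasFDerivAt.comp y (hasFDerivAt_prodMk_right t y)

theorem continuousOn_fderiv_slice (hs : IsOpen s) (hG : ContDiffOn ℝ ∞ G (Set.univ ×ˢ s)) :
    ContinuousOn (fun q => (fderiv ℝ G q).comp (.inr ℝ ℝ P)) (Set.univ ×ˢ s) :=
  (hG.continuousOn_fderiv_of_isOpen (isOpen_univ.prod hs) (by simp)).clm_comp continuousOn_const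

theorem fderiv_integral_unit [ProperSpace P] (hs : IsOpen s)
    (hG : ContDiffOn ℝ ∞ G (Set.univ ×ˢ s)) {y : P} (hy : y ∈ s) (v : P) :
    fderiv ℝ (fun p => ∫ t in (0 : ℝ)..1, G (t, p)) y v =
      ∫ t in (0 : ℝ)..1, fderiv ℝ (fun p => G (t, p)) y v := by
  let G' : P → ℝ → P →L[ℝ] ℝ := fun p t => (fderiv ℝ G (t, p)).comp (.inr ℝ ℝ P)
  have hG'_continuous : Continuous (G' y) :=
    continuous_slice (continuousOn_fderiv_slice hs hG) hy
  obtain ⟨ε, hε, h_ball⟩ := Metric.nhds_basis_closedBall.mem_iff.1 (hs.mem_nhds hy)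
  obtain ⟨C, hC⟩ := (isCompact_Icc.prod (isCompact_closedBall y ε)).exists_bound_of_continuousOn
    ((continuousOn_fderiv_slice hs hG).mono
      (Set.prod_mono (Set.subset_univ (Set.Icc (0 : ℝ) 1)) h_ball))
  have h_deriv := intervalIntegral.hasFDerivAt_integral_of_dominated_of_fderiv_le (𝕜 := ℝ)
    (μ := MeasureTheory.volume) (a := 0) (b := 1) (F := fun p t => G (t, p)) (F' := G')
    (bound := fun _ => C) (Metric.closedBall_mem_nhds y hε)
    (Filter.eventually_of_mem (hs.mem_nhds hy) fun p hp =>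
      (continuous_slice hG.continuousOn hp).aestronglyMeasurable)
    ((continuous_slice hG.continuousOn hy).intervalIntegrable 0 1)
    hG'_continuous.aestronglyMeasurable
    (.of_forall fun t ht p hp => hC (t, p)
      ⟨Set.Ioc_subset_Icc_self (by rwa [Set.uIoc_of_le zero_le_one] at ht), hp⟩)
    intervalIntegrable_const
    (.of_forall fun t _ p hp => hasFDerivAt_slice hs hG (h_ball hp) t)
  rw [h_deriv.fderiv,
    ContinuousLinearMap.intervalIntegral_apply (hG'_continuous.intervalIntegrable 0 1)]
  exact intervalIntegral.integral_congr fun t _ => by rw [(hasFDerivAt_slice hs hG hy t).fderiv]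

end Integral

section CylinderCalculus

variable {n : ℕ} {M : Type*} [TopologicalSpace M] [ChartedSpace (EuclideanSpace ℝ (Fin n)) M]
  [IsManifold (𝓡 n) ∞ M]

theorem contDiffOn_cylinder_chart (f : C^∞⟮cylModel n, ℝ × M; 𝓘(ℝ, ℝ), ℝ⟯) (x : M) :
    ContDiffOn ℝ ∞
      (fun q : ℝ × EuclideanSpace ℝ (Fin n) => f (q.1, (extChartAt (𝓡 n) x).symm q.2))
      (Set.univ ×ˢ (extChartAt (𝓡 n) x).target) := by
  rintro ⟨t, y⟩ ⟨-, hy⟩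
  have h_chart : ContMDiffAt 𝓘(ℝ, EuclideanSpace ℝ (Fin n)) (𝓡 n) ∞ (extChartAt (𝓡 n) x).symm y :=
    (contMDiffOn_extChartAt_symm x).contMDiffAt ((isOpen_extChartAt_target x).mem_nhds hy)
  have h_inclusion : ContMDiffAt (𝓘(ℝ, ℝ).prod 𝓘(ℝ, EuclideanSpace ℝ (Fin n))) (cylModel n) ∞
      (fun q : ℝ × EuclideanSpace ℝ (Fin n) => (q.1, (extChartAt (𝓡 n) x).symm q.2)) (t, y) :=
    contMDiffAt_fst.prodMk (ContMDiffAt.comp (t, y) h_chart contMDiffAt_snd)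
  have h_smooth := f.contMDiff.contMDiffAt.comp (t, y) h_inclusion
  rw [← modelWithCornersSelf_prod, chartedSpaceSelf_prod] at h_smooth
  exact h_smooth.contDiffAt.contDiffWithinAt

theorem vectorFieldDerivation_eq_fderiv
    (X : Cₛ^∞⟮𝓡 n; EuclideanSpace ℝ (Fin n), (TangentSpace (𝓡 n) : M → Type _)⟯)
    (g : C^∞⟮𝓡 n, M; 𝓘(ℝ, ℝ), ℝ⟯) (x : M) :
    vectorFieldDerivation X g x = fderiv ℝ (fun y => g ((extChartAt (𝓡 n) x).symm y))
      (extChartAt (𝓡 n) x x) (X x : EuclideanSpace ℝ (Fin n)) := by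
  refine (congrArg (fun L => L (X x)) (g.mdifferentiableAt (x := x)).mfderiv).trans ?_
  change fderivWithin ℝ (fun y => g ((extChartAt (𝓡 n) x).symm y)) (Set.range (𝓡 n)) _ _ = _
  rw [ModelWithCorners.range_eq_univ, fderivWithin_univ]

theorem cylIntegral_vectorFieldDerivation
    (X : Cₛ^∞⟮𝓡 n; EuclideanSpace ℝ (Fin n), (TangentSpace (𝓡 n) : M → Type _)⟯)
    (f : C^∞⟮cylModel n, ℝ × M; 𝓘(ℝ, ℝ), ℝ⟯) :
    cylIntegral (vectorFieldDerivation (cylField (0, X)) f) =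
      vectorFieldDerivation X (cylIntegral f) := by
  ext x
  rw [vectorFieldDerivation_eq_fderiv, cylIntegral_apply]
  refine .trans ?_ (fderiv_integral_unit (isOpen_extChartAt_target x)
    (contDiffOn_cylinder_chart f x) (mem_extChartAt_target x) _).symm
  refine intervalIntegral.integral_congr fun t _ => ?_
  rw [cylField_derivation_apply, zero_mul, zero_add, vectorFieldDerivation_eq_fderiv]
  rfl

theorem cylIntegral_time_derivation (f : C^∞⟮cylModel n, ℝ × M; 𝓘(ℝ, ℝ), ℝ⟯) :
    cylIntegral (vectorFieldDerivation (cylField (1, 0)) f) = cylSlice 1 f - cylSlice 0 f := by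
  ext x
  have h_smooth : ContDiff ℝ ∞ fun t : ℝ => f (t, x) :=
    (f.contMDiff.comp (contMDiff_id.prodMk contMDiff_const)).contDiff
  rw [cylIntegral_apply]
  simp only [cylField_derivation_time]
  exact intervalIntegral.integral_deriv_eq_sub
    (fun t _ => (h_smooth.differentiable (by simp)).differentiableAt)
    ((h_smooth.continuous_deriv (by simp)).intervalIntegrable 0 1)

end CylinderCalculus

section Transgression

variable {n : ℕ} {M : Type*} [TopologicalSpace M]
  [ChartedSpace (EuclideanSpace ℝ (Fin n)) M] [IsManifold (𝓡 n) ∞ M] [T2Space M]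
  {FA : Type*} [NormedAddCommGroup FA] [NormedSpace ℝ FA] [FiniteDimensional ℝ FA]
  {A : M → Type*} [TopologicalSpace (TotalSpace FA A)] [∀ x, AddCommGroup (A x)]
  [∀ x, Module ℝ (A x)] [∀ x, TopologicalSpace (A x)] [FiberBundle FA A]
  [VectorBundle ℝ FA A] [ContMDiffVectorBundle ∞ FA A (𝓡 n)]
  {F : Type*} [NormedAddCommGroup F] [NormedSpace ℝ F] [FiniteDimensional ℝ F]
  {V : M → Type*} [TopologicalSpace (TotalSpace F V)] [∀ x, AddCommGroup (V x)]
  [∀ x, Module ℝ (V x)] [∀ x, TopologicalSpace (V x)] [FiberBundle F V] [VectorBundle ℝ F V]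
  [ContMDiffVectorBundle ∞ F V (𝓡 n)]

namespace LieAlgebroid

variable {𝒜 : LieAlgebroid n FA A}

section Slice

variable {D₀ D₁ D : 𝒜.Connection F V} {t : ℝ}

theorem cylRestrict_affineConnection (hD : ∀ a s, D a s = (1 - t) • D₀ a s + t • D₁ a s)
    (a : 𝒜.Sec) (σ : CylSection n F V) :
    cylRestrict t (affineConnection D₀ D₁ (0, a) σ) = D a (cylRestrict t σ) := by
  rw [hD, affineConnection_apply, zero_smul, zero_add]
  rfl

theorem cylRestrict_curvature_affineConnection
    (hD : ∀ a s, D a s = (1 - t) • D₀ a s + t • D₁ a s) (a b : 𝒜.Sec) (σ : CylSection n F V) :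
    cylRestrict t ((affineConnection D₀ D₁).curvature (0, a) (0, b) σ) =
      D.curvature a b (cylRestrict t σ) := by
  have h_sub : ∀ σ τ : CylSection n F V,
      cylRestrict t (σ - τ) = cylRestrict t σ - cylRestrict t τ := fun _ _ => rfl
  have h_lie : ⁅((0 : ℝ), a), ((0 : ℝ), b)⁆ = ((0 : ℝ), ⁅a, b⁆) := rfl
  simp only [RLinearConnection.curvature_apply, h_sub, h_lie, cylRestrict_affineConnection hD]

theorem fibreCurvature_affineConnection (hD : ∀ a s, D a s = (1 - t) • D₀ a s + t • D₁ a s)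
    (a b : 𝒜.Sec) (x : M) :
    (affineConnection D₀ D₁).fibreCurvature (t, x) (0, a) (0, b) = D.fibreCurvature x a b := by
  obtain ⟨ε, hε⟩ := exists_section_extension (F := F) (V := V) (𝓡 n) x
  refine LinearMap.ext fun v => ?_
  have h_cyl : (affineConnection D₀ D₁).fibreCurvature (t, x) (0, a) (0, b) (ε v x) =
      (affineConnection D₀ D₁).curvature (0, a) (0, b) (cylPull (ε v)) (t, x) :=
    RLinearConnection.fibreCurvature_apply _ (t, x) _ _ (cylPull (ε v))
  have h_slice : (affineConnection D₀ D₁).curvature (0, a) (0, b) (cylPull (ε v)) (t, x) =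
      D.curvature a b (ε v) x :=
    DFunLike.congr_fun (cylRestrict_curvature_affineConnection hD a b (cylPull (ε v))) x
  rw [← hε v]
  exact h_cyl.trans (h_slice.trans (D.fibreCurvature_apply x a b (ε v)).symm)

theorem cylSlice_chernForm_affineConnection
    (hD : ∀ a s, D a s = (1 - t) • D₀ a s + t • D₁ a s) (p : ℕ) (a : Fin (2 * p) → 𝒜.Sec) :
    cylSlice t ((affineConnection D₀ D₁).chernForm p fun i => (0, a i)) = D.chernForm p a := by
  ext x
  rw [cylSlice_apply, RLinearConnection.chernForm_apply_apply,
    RLinearConnection.chernForm_apply_apply]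
  exact congrArg (LinearMap.trace ℝ (V x))
    (alternatingPower_congr (B := Module.End ℝ (V x)) fun i j =>
      fibreCurvature_affineConnection hD (a i) (a j) x)

end Slice

theorem d_chernForm (D : 𝒜.Connection F V) (p : ℕ) : 𝒜.d (2 * p) (D.chernForm p) = 0 :=
  D.koszulDifferential_chernForm p

/-- Integration along the fibres of `ℝ × M → M` of forms on `ℝ ∂/∂t ⊕ Γ(A)`, restricted to
`Γ(A)`. -/
def fibreIntegral {k : ℕ} (η : AltForm (ℝ × 𝒜.Sec) C^∞⟮cylModel n, ℝ × M; 𝓘(ℝ, ℝ), ℝ⟯ k) :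
    𝒜.Form k :=
  cylIntegral.compAlternatingMap (η.compLinearMap (LinearMap.inr ℝ ℝ 𝒜.Sec))

theorem d_fibreIntegral {k : ℕ}
    (η : AltForm (ℝ × 𝒜.Sec) C^∞⟮cylModel n, ℝ × M; 𝓘(ℝ, ℝ), ℝ⟯ (k + 1)) :
    𝒜.d (k + 1) (fibreIntegral η) =
      fibreIntegral (koszulDifferential (derivationAction 𝒜.cylDerivation) (k + 1) η) := by
  refine (koszulDifferential_compAlternatingMap cylIntegral
    (D := derivationAction 𝒜.cylDerivation ∘ₗ LinearMap.inr ℝ ℝ 𝒜.Sec) (D' := 𝒜.anchorAction)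
    (fun a f => cylIntegral_vectorFieldDerivation (𝒜.anchorField a) f) _).trans ?_
  exact congrArg cylIntegral.compAlternatingMap
    (koszulDifferential_compLinearMap _ (LieHom.inr ℝ ℝ 𝒜.Sec) η)

theorem koszulDifferential_interiorProduct_chernForm (D₀ D₁ : 𝒜.Connection F V) (p : ℕ) :
    koszulDifferential (derivationAction 𝒜.cylDerivation) (2 * p + 1)
        (interiorProduct (1, 0) ((affineConnection D₀ D₁).chernForm (p + 1))) =
      (derivationAction 𝒜.cylDerivation (1, 0)).compAlternatingMap
        ((affineConnection D₀ D₁).chernForm (p + 1)) := by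
  have h_cartan := interiorProduct_koszulDifferential_of_central (n := 2 * p)
    (c := ((1 : ℝ), (0 : 𝒜.Sec))) (derivationAction 𝒜.cylDerivation)
    ((affineConnection D₀ D₁).chernForm (p + 1)) fun u => Prod.ext rfl (zero_lie u.2)
  have h_closed := (affineConnection D₀ D₁).koszulDifferential_chernForm (p + 1)
  exact (sub_eq_zero.1 (h_cartan.symm.trans
    ((congrArg (interiorProduct (1, 0)) h_closed).trans (map_zero _)))).symm

theorem d_chernSimons (D₀ D₁ : 𝒜.Connection F V) (p : ℕ) :
    𝒜.d (2 * p + 1) (chernSimons D₀ D₁ p) = D₁.chernForm (p + 1) - D₀.chernForm (p + 1) := by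
  let ch := (affineConnection D₀ D₁).chernForm (p + 1)
  refine (d_fibreIntegral (k := 2 * p) (interiorProduct (1, 0) ch)).trans ?_
  rw [koszulDifferential_interiorProduct_chernForm]
  ext1 a
  calc cylIntegral (vectorFieldDerivation (cylField (1, 𝒜.anchorField 0)) (ch fun i => (0, a i)))
      = cylSlice 1 (ch fun i => (0, a i)) - cylSlice 0 (ch fun i => (0, a i)) := by
        rw [map_zero, cylIntegral_time_derivation]
    _ = D₁.chernForm (p + 1) a - D₀.chernForm (p + 1) a :=
        congrArg₂ (· - ·)
          (cylSlice_chernForm_affineConnection (fun _ _ => by module) (p + 1) a)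
          (cylSlice_chernForm_affineConnection (fun _ _ => by module) (p + 1) a)

theorem cohomologyClass_eq_of_d_eq_sub {k : ℕ} {η θ : 𝒜.Form (k + 1)}
    (hη : 𝒜.d (k + 1) η = 0) (hθ : 𝒜.d (k + 1) θ = 0) (ζ : 𝒜.Form k) (h : 𝒜.d k ζ = θ - η) :
    𝒜.cohomologyClass η hη = 𝒜.cohomologyClass θ hθ := by
  refine ((Submodule.Quotient.eq _).2 ?_).symm
  exact ⟨ζ, h⟩

theorem cohomologyClass_chernForm_eq (D₀ D₁ : 𝒜.Connection F V) (p : ℕ)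
    (h₀ : 𝒜.d (2 * (p + 1)) (D₀.chernForm (p + 1)) = 0)
    (h₁ : 𝒜.d (2 * (p + 1)) (D₁.chernForm (p + 1)) = 0) :
    𝒜.cohomologyClass (D₀.chernForm (p + 1)) h₀ = 𝒜.cohomologyClass (D₁.chernForm (p + 1)) h₁ :=
  cohomologyClass_eq_of_d_eq_sub h₀ h₁ (chernSimons D₀ D₁ p) (d_chernSimons D₀ D₁ p)

end LieAlgebroid

end Transgression

section FrameConnection

variable {L : Type*} [LieRing L] [LieAlgebra ℝ L] {R : Type*} [CommRing R] [Algebra ℝ R]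
  {W : Type*} [AddCommGroup W] [Module ℝ W] [Module R W] [IsScalarTower ℝ R W] {r : ℕ}

/-- The operators `σ ↦ ∑ᵢ δ_a(cᵢ σ) sᵢ`. If the `cᵢ` are the coordinates with respect to a basis
`s`, they form the connection for which all `sᵢ` are parallel. -/
def frameConnection (δ : L →ₗ⁅ℝ⁆ Derivation ℝ R R) (c : Fin r → W →ₗ[R] R) (s : Fin r → W) :
    L →ₗ[ℝ] Module.End ℝ W :=
  LinearMap.mk₂ ℝ (fun a σ => ∑ i, δ a (c i σ) • s i)
    (fun a b σ => by
      simp only [map_add, Derivation.add_apply, add_smul, Finset.sum_add_distrib])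
    (fun t a σ => by
      simp only [map_smul, Derivation.smul_apply, smul_assoc, Finset.smul_sum])
    (fun a σ τ => by simp only [map_add, add_smul, Finset.sum_add_distrib])
    (fun t a σ => by
      simp only [LinearMap.map_smul_of_tower, Derivation.map_smul, smul_assoc, Finset.smul_sum])

variable {δ : L →ₗ⁅ℝ⁆ Derivation ℝ R R} (c : Fin r → W →ₗ[R] R) (s : Fin r → W)

theorem frameConnection_apply (a : L) (σ : W) :
    frameConnection δ c s a σ = ∑ i, δ a (c i σ) • s i := rfl

theorem frameConnection_leibniz {χ : R} {c : Fin r → W →ₗ[R] R} {s : Fin r → W}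
    (hc : ∀ σ, χ • σ = ∑ i, c i σ • s i) (a : L) (f : R) (σ : W) :
    frameConnection δ c s a (f • σ) = f • frameConnection δ c s a σ + δ a f • χ • σ := by
  simp only [frameConnection_apply, hc, map_smul, smul_eq_mul, Derivation.leibniz, add_smul,
    mul_smul, Finset.sum_add_distrib, Finset.smul_sum, smul_comm (c _ σ)]

theorem frameConnection_smul [Module R L] (hδ : ∀ (g : R) a f, δ (g • a) f = g * δ a f) (g : R)
    (a : L) (σ : W) : frameConnection δ c s (g • a) σ = g • frameConnection δ c s a σ := by
  simp only [frameConnection_apply, hδ, mul_smul, Finset.smul_sum]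

end FrameConnection

section Existence

variable {E : Type*} [NormedAddCommGroup E] [NormedSpace ℝ E]
  {H : Type*} [TopologicalSpace H] {I : ModelWithCorners ℝ E H}
  {N : Type*} [TopologicalSpace N] [ChartedSpace H N]
  {F : Type*} [NormedAddCommGroup F] [NormedSpace ℝ F]
  {V : N → Type*} [TopologicalSpace (TotalSpace F V)] [∀ x, AddCommGroup (V x)]
  [∀ x, Module ℝ (V x)] [∀ x, TopologicalSpace (V x)] [FiberBundle F V] [VectorBundle ℝ F V]

section Gluing

variable {ι : Type*} (ρ : SmoothPartitionOfUnity ι I N)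

/-- Gluing a family of sections by a partition of unity, as a map of modules over the smooth
functions. -/
def glueSections : (ι → Cₛ^∞⟮I; F, V⟯) →ₗ[C^∞⟮I, N; 𝓘(ℝ, ℝ), ℝ⟯] Cₛ^∞⟮I; F, V⟯ where
  toFun σ := ⟨fun x => ∑ᶠ i, ρ i x • σ i x,
    ContMDiff.finsum_section_of_locallyFinite
      (ρ.locallyFinite.subset fun _ _ => left_ne_zero_of_smul)
      fun i => (ρ i).contMDiff.smul_section (σ i).contMDiff⟩
  map_add' σ τ := ContMDiffSection.ext fun x =>
    have h_finite (σ : ι → Cₛ^∞⟮I; F, V⟯) : (Function.support fun i => ρ i x • σ i x).Finite :=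
      (ρ.locallyFinite.point_finite x).subset fun _ => left_ne_zero_of_smul
    (finsum_congr fun i => smul_add (ρ i x) (σ i x) (τ i x)).trans
      (finsum_add_distrib (h_finite σ) (h_finite τ))
  map_smul' f σ := ContMDiffSection.ext fun x =>
    (finsum_congr fun i => smul_comm (ρ i x) (f x) (σ i x)).trans
      (smul_finsum (f x) fun i => ρ i x • σ i x).symm

theorem glueSections_apply (σ : ι → Cₛ^∞⟮I; F, V⟯) (x : N) :
    glueSections ρ σ x = ∑ i ∈ ρ.finsupport x, ρ i x • σ i x :=
  (ρ.sum_finsupport_smul_eq_finsum x fun i _ => (σ i x : V x)).symm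

theorem glueSections_smul_eq_self {χ : ι → C^∞⟮I, N; 𝓘(ℝ, ℝ), ℝ⟯}
    (hρ : ρ.IsSubordinate fun i => interior {y | χ i y = 1}) (σ : Cₛ^∞⟮I; F, V⟯) :
    glueSections ρ (fun i => χ i • σ) = σ := by
  ext1 x
  have h_term : ∀ i ∈ ρ.finsupport x, ρ i x • (χ i • σ) x = ρ i x • σ x := by
    intro i hi
    have hx : x ∈ interior {y | χ i y = 1} := hρ i (subset_tsupport _ ((ρ.mem_finsupport x).1 hi))
    have hχ : χ i x = 1 := interior_subset (s := {y | χ i y = 1}) hx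
    rw [ContMDiffSection.smooth_smul_apply, hχ, one_smul]
  rw [glueSections_apply, Finset.sum_congr rfl h_term, ← Finset.sum_smul,
    ρ.sum_finsupport x (Set.mem_univ x), one_smul]

end Gluing

variable [FiniteDimensional ℝ E] [IsManifold I ∞ N] [T2Space N] [SigmaCompactSpace N]
  [FiniteDimensional ℝ F] [ContMDiffVectorBundle ∞ F V I]
  {L : Type*} [LieRing L] [LieAlgebra ℝ L] [Module C^∞⟮I, N; 𝓘(ℝ, ℝ), ℝ⟯ L]
  {δ : L →ₗ⁅ℝ⁆ Derivation ℝ C^∞⟮I, N; 𝓘(ℝ, ℝ), ℝ⟯ C^∞⟮I, N; 𝓘(ℝ, ℝ), ℝ⟯}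

theorem RLinearConnection.exists_smooth_linear
    (hδ : ∀ (g : C^∞⟮I, N; 𝓘(ℝ, ℝ), ℝ⟯) a f, δ (g • a) f = g * δ a f) :
    ∃ D : RLinearConnection δ Cₛ^∞⟮I; F, V⟯,
      ∀ (g : C^∞⟮I, N; 𝓘(ℝ, ℝ), ℝ⟯) a σ, D (g • a) σ = g • D a σ := by
  choose r χ s c hχ hc using exists_local_dual_frame (I := I) (F := F) (V := V)
  obtain ⟨ρ, hρ⟩ := SmoothPartitionOfUnity.exists_isSubordinate I isClosed_univ
    (fun x => interior {y | χ x y = 1}) (fun _ => isOpen_interior)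
    fun x _ => Set.mem_iUnion.2 ⟨x, mem_interior_iff_mem_nhds.2 (hχ x)⟩
  let D : RLinearConnection δ Cₛ^∞⟮I; F, V⟯ :=
    { toLinearMap := LinearMap.mk₂ ℝ
        (fun a σ => glueSections ρ fun x => frameConnection δ (c x) (s x) a σ)
        (fun a b σ => by simp only [map_add, LinearMap.add_apply]; exact map_add _ _ _)
        (fun t a σ => by
          simp only [map_smul, LinearMap.smul_apply]
          exact LinearMap.map_smul_of_tower (glueSections ρ) t _)
        (fun a σ τ => by simp only [map_add]; exact map_add _ _ _)
        (fun t a σ => by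
          simp only [map_smul]
          exact LinearMap.map_smul_of_tower (glueSections ρ) t _)
      leibniz := fun a f σ => by
        simp only [LinearMap.mk₂_apply, frameConnection_leibniz (hc _)]
        refine (map_add (glueSections ρ) (f • _) (δ a f • fun x => χ x • σ)).trans ?_
        rw [map_smul, map_smul, glueSections_smul_eq_self ρ hρ] }
  refine ⟨D, fun g a σ => ?_⟩
  refine Eq.trans ?_ (map_smul (glueSections ρ) g _)
  exact congrArg (glueSections ρ) (funext fun x => frameConnection_smul (c x) (s x) hδ g a σ)

end Existence

section ChernCharacter

variable {n : ℕ} {M : Type*} [TopologicalSpace M]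
  [ChartedSpace (EuclideanSpace ℝ (Fin n)) M] [IsManifold (𝓡 n) ∞ M] [T2Space M]
  {FA : Type*} [NormedAddCommGroup FA] [NormedSpace ℝ FA] [FiniteDimensional ℝ FA]
  {A : M → Type*} [TopologicalSpace (TotalSpace FA A)] [∀ x, AddCommGroup (A x)]
  [∀ x, Module ℝ (A x)] [∀ x, TopologicalSpace (A x)] [FiberBundle FA A]
  [VectorBundle ℝ FA A] [ContMDiffVectorBundle ∞ FA A (𝓡 n)]

namespace LieAlgebroid

theorem anchorDerivation_smul (𝒜 : LieAlgebroid n FA A) (g : C^∞⟮𝓡 n, M; 𝓘(ℝ, ℝ), ℝ⟯)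
    (a : 𝒜.Sec) (f : C^∞⟮𝓡 n, M; 𝓘(ℝ, ℝ), ℝ⟯) :
    𝒜.anchorDerivation (g • a) f = g * 𝒜.anchorDerivation a f := by
  ext x
  change mfderiv (𝓡 n) 𝓘(ℝ, ℝ) f x (𝒜.anchor x (g x • (show Cₛ^∞⟮𝓡 n; FA, A⟯ from a) x)) =
    g x • mfderiv (𝓡 n) 𝓘(ℝ, ℝ) f x (𝒜.anchor x ((show Cₛ^∞⟮𝓡 n; FA, A⟯ from a) x))
  rw [map_smul, map_smul]

theorem cohomologyClass_eq_zero {𝒜 : LieAlgebroid n FA A} {k : ℕ} {η : 𝒜.Form k}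
    (h : 𝒜.d k η = 0) (hη : η = 0) : 𝒜.cohomologyClass η h = 0 := by
  subst hη
  exact Submodule.Quotient.mk_zero _

variable {F : Type*} [NormedAddCommGroup F] [NormedSpace ℝ F] [FiniteDimensional ℝ F]
  {V : M → Type*} [TopologicalSpace (TotalSpace F V)] [∀ x, AddCommGroup (V x)]
  [∀ x, Module ℝ (V x)] [∀ x, TopologicalSpace (V x)] [FiberBundle F V] [VectorBundle ℝ F V]
  [ContMDiffVectorBundle ∞ F V (𝓡 n)]

section SmoothLinear

variable {𝒜 : LieAlgebroid n FA A} {D : 𝒜.Connection F V}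
  (hD : ∀ (g : C^∞⟮𝓡 n, M; 𝓘(ℝ, ℝ), ℝ⟯) (a : 𝒜.Sec) σ, D (g • a) σ = g • D a σ)
include hD

theorem fibreCurvature_congr_left {x : M} {a a' : 𝒜.Sec}
    (h : (show Cₛ^∞⟮𝓡 n; FA, A⟯ from a) x = (show Cₛ^∞⟮𝓡 n; FA, A⟯ from a') x) (b : 𝒜.Sec) :
    D.fibreCurvature x a b = D.fibreCurvature x a' b :=
  map_eq_of_apply_eq (F := FA) (V := A) ((D.fibreCurvature x).flip b).toAddMonoidHom
    (fun g a => congrArg (fibreEndAlgHom x)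
      (D.curvature_smul_left hD (fun b a => 𝒜.leibniz b a) g a b)) h

theorem fibreCurvature_congr {x : M} {a a' b b' : 𝒜.Sec}
    (ha : (show Cₛ^∞⟮𝓡 n; FA, A⟯ from a) x = (show Cₛ^∞⟮𝓡 n; FA, A⟯ from a') x)
    (hb : (show Cₛ^∞⟮𝓡 n; FA, A⟯ from b) x = (show Cₛ^∞⟮𝓡 n; FA, A⟯ from b') x) :
    D.fibreCurvature x a b = D.fibreCurvature x a' b' := by
  rw [fibreCurvature_congr_left hD ha, D.fibreCurvature_skew, fibreCurvature_congr_left hD hb,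
    ← D.fibreCurvature_skew]

theorem chernForm_eq_zero_of_rank_lt {p : ℕ} (hp : Module.finrank ℝ FA < 2 * p) :
    D.chernForm p = 0 := by
  ext a x
  have : FiniteDimensional ℝ (A x) := VectorBundle.finiteDimensional ℝ FA A x
  obtain ⟨ε, hε⟩ := exists_section_extension (F := FA) (V := A) (𝓡 n) x
  let evalAt : 𝒜.Sec →ₗ[ℝ] A x :=
    { toFun := fun a => (show Cₛ^∞⟮𝓡 n; FA, A⟯ from a) x
      map_add' := fun _ _ => rfl
      map_smul' := fun _ _ => rfl }
  have h_vanish : alternatingPower (B := Module.End ℝ (V x)) (D.fibreCurvature x) p = 0 :=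
    alternatingPower_eq_zero_of_finrank_lt (q := evalAt) (fun v => ⟨ε v, hε v⟩)
      (fun _ _ _ _ => fibreCurvature_congr hD) (by rwa [VectorBundle.finrank_eq ℝ FA A x])
  rw [D.chernForm_apply_apply]
  refine (congrArg (LinearMap.trace ℝ (V x)) (DFunLike.congr_fun h_vanish a)).trans ?_
  exact map_zero _

end SmoothLinear

theorem existsUnique_chernCharacter [SigmaCompactSpace M] (𝒜 : LieAlgebroid n FA A) :
    ∃! c : DirectSum ℕ (fun k => 𝒜.Cohomology k),
      (∀ (D : 𝒜.Connection F V) (p : ℕ),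
        ∃ h : 𝒜.d (2 * (p + 1)) (D.chernForm (p + 1)) = 0,
          c (2 * (p + 1)) = 𝒜.cohomologyClass (D.chernForm (p + 1)) h) ∧
      ∀ k : ℕ, (¬ ∃ p : ℕ, k = 2 * (p + 1)) → c k = 0 := by
  obtain ⟨D₀, hD₀⟩ : ∃ D : 𝒜.Connection F V, ∀ (g : C^∞⟮𝓡 n, M; 𝓘(ℝ, ℝ), ℝ⟯) (a : 𝒜.Sec) σ,
    D (g • a) σ = g • D a σ := RLinearConnection.exists_smooth_linear 𝒜.anchorDerivation_smul
  let chernClass (p : ℕ) : 𝒜.Cohomology (2 * (p + 1)) :=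
    𝒜.cohomologyClass (D₀.chernForm (p + 1)) (d_chernForm D₀ (p + 1))
  have h_finite : {p | chernClass p ≠ 0}.Finite := by
    refine (Set.finite_lt_nat (Module.finrank ℝ FA)).subset fun p hp => ?_
    by_contra h_le
    rw [Set.mem_ofPred_eq, not_lt] at h_le
    exact hp (cohomologyClass_eq_zero _ (chernForm_eq_zero_of_rank_lt hD₀ (by omega)))
  have h_injective : Function.Injective fun p : ℕ => 2 * (p + 1) := fun p q h => by
    simp only at h
    omega
  refine (existsUnique_congr fun c => and_congr_left fun _ => ⟨fun h p => ?_, fun h D p => ?_⟩).2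
    (existsUnique_directSum_of_injective h_injective chernClass h_finite)
  · exact (h D₀ p).choose_spec
  · exact ⟨d_chernForm D (p + 1), (h p).trans (cohomologyClass_chernForm_eq D₀ D p _ _)⟩

end LieAlgebroid

end ChernCharacter

end

theorem mainTheorem2 {n : ℕ} {M : Type*} [TopologicalSpace M]
    [ChartedSpace (EuclideanSpace ℝ (Fin n)) M] [IsManifold (𝓡 n) ∞ M] [T2Space M]
    [SigmaCompactSpace M]
    {FA : Type*} [NormedAddCommGroup FA] [NormedSpace ℝ FA] [FiniteDimensional ℝ FA]
    {A : M → Type*} [TopologicalSpace (TotalSpace FA A)] [∀ x, AddCommGroup (A x)]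
    [∀ x, Module ℝ (A x)] [∀ x, TopologicalSpace (A x)] [FiberBundle FA A]
    [VectorBundle ℝ FA A] [ContMDiffVectorBundle ∞ FA A (𝓡 n)]
    {F : Type*} [NormedAddCommGroup F] [NormedSpace ℝ F] [FiniteDimensional ℝ F]
    {E : M → Type*} [TopologicalSpace (TotalSpace F E)] [∀ x, AddCommGroup (E x)]
    [∀ x, Module ℝ (E x)] [∀ x, TopologicalSpace (E x)] [FiberBundle F E] [VectorBundle ℝ F E]
    [ContMDiffVectorBundle ∞ F E (𝓡 n)]
    (𝒜 : LieAlgebroid n FA A) :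
    (∀ (D : 𝒜.Connection F E) (p : ℕ), 𝒜.d (2 * (p + 1)) (D.chernForm (p + 1)) = 0) ∧
    (∀ (D₀ D₁ : 𝒜.Connection F E) (p : ℕ),
      𝒜.d (2 * p + 1) (LieAlgebroid.chernSimons D₀ D₁ p) =
        D₁.chernForm (p + 1) - D₀.chernForm (p + 1)) ∧
    (∀ (D₀ D₁ : 𝒜.Connection F E) (p : ℕ) (h₀ : 𝒜.d (2 * (p + 1)) (D₀.chernForm (p + 1)) = 0)
      (h₁ : 𝒜.d (2 * (p + 1)) (D₁.chernForm (p + 1)) = 0),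
      𝒜.cohomologyClass (D₀.chernForm (p + 1)) h₀ =
        𝒜.cohomologyClass (D₁.chernForm (p + 1)) h₁) ∧
    (∃! c : DirectSum ℕ (fun k => 𝒜.Cohomology k),
      (∀ (D : 𝒜.Connection F E) (p : ℕ),
        ∃ h : 𝒜.d (2 * (p + 1)) (D.chernForm (p + 1)) = 0,
          c (2 * (p + 1)) = 𝒜.cohomologyClass (D.chernForm (p + 1)) h) ∧
      ∀ k : ℕ, (¬ ∃ p : ℕ, k = 2 * (p + 1)) → c k = 0) :=
  ⟨fun D p => LieAlgebroid.d_chernForm D (p + 1), LieAlgebroid.d_chernSimons,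
    LieAlgebroid.cohomologyClass_chernForm_eq, LieAlgebroid.existsUnique_chernCharacter 𝒜⟩
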